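/- Setting. Let $(X,Y)$ have law $P$, where $Y\in\{0,1\}$ and $X$ takes values in a measurable covariate space $\mathbb S$, and let $p(X)=P(Y=1\mid X)$. Let $K$ be fixed. The data are $n$ i.i.d. copies of $(X,Y)$, split (by a split independent of the data) into a training set $D_{n_1}$ of size $n_1=n_1(n)$ and a test set $(x_{e,i},y_{e,i})_{i\le n_2}$ of size $n_2=n_2(n)$, $n_1+n_2=n$. The model to assess is a class $\mathcal M$ of regression functions; the null hypothesis is $p\in\mathcal M$ and the alternative is $p\notin\mathcal M$. Fitting on a data set $D$ yields an estimated regression function $\hat p_{D}$, and $D_{n_1}$ determines a partition $\{\hat G_{D_{n_1},1},\dots,\hat G_{D_{n_1},K}\}$ of $\mathbb S$. With $R_i=y_{e,i}-\hat p_{D_{n_1}}(x_{e,i})$ and $\sigma_i^2=\hat p_{D_{n_1}}(x_{e,i})\{1-\hat p_{D_{n_1}}(x_{e,i})\}$, let $$\mathrm{BAG}=\sum_{k=1}^K\left(\frac{\sum_{i:\,x_{e,i}\in\hat G_{D_{n_1},k}}R_i}{\sqrt{\sum_{i:\,x_{e,i}\in\hat G_{D_{n_1},k}}\sigma_i^2}}\right)^2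 .$$ Assume the following, where $D_m$ denotes a data set of $m$ i.i.d. observations from $P$. 1. For each $k$, the number $N_k=\#\{i\le n_2: x_{e,i}\in\hat G_{D_{n_1},k}\}$ tends to infinity in probability at the rate $n_2$, that is, $n_2/N_k$ is stochastically bounded as $n\to\infty$. 2. There is $0<c_2<1/2$ with $c_2\le p(X)\le 1-c_2$ almost surely. 3. If the null hypothesis holds, then $\sup_{x\in\mathbb S}|\hat p_{D_m}(x)-p(x)|=O_p(m^{-1/2})$ as $m\to\infty$. 4. If the alternative holds, then there is a measurable $p_a:\mathbb S\to[0,1]$ with $\sup_{x\in\mathbb S}|\hat p_{D_m}(x)-p_a(x)|=O_p(m^{-1/2})$ as $m\to\infty$, and there is $c_3>0$ with $c_3\le p_a(X)\le 1-c_3$ almost surely. 5. If the alternative holds, then, for the function $p_a$ of condition 4, there is $c_4>0$ such that, with probability tending to one as $n\to\infty$, $$\max_{k=1,\dots,K}\Big|E_X\big[I\{X\in\hat G_{D_{n_1},k}\}\,(p(X)-p_a(X))\big]\Big|>c_4,$$ where $E_X$ is the expectation over a new $X$, independent of $D_{n_1}$, with $D_{n_1}$ held fixed. Suppose that $n_2\to\infty$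 and $n_2/n_1\to0$ as $n\to\infty$ (in particular $n_1>0$ for large $n$). Then, as $n\to\infty$, $\mathrm{BAG}\to\chi^2_K$ in distribution under the null hypothesis, and $\mathrm{BAG}\to\infty$ in probability (that is, $\Pr(\mathrm{BAG}\le M)\to0$ for every $M$) under the alternative. -/

import Mathlib

open MeasureTheory ProbabilityTheory Filter Topology
open scoped ENNReal

/-- An observation `(x, y)`: a covariate vector `x` in the covariate space `S` and a binary
response `y`. -/
abbrev Obs (S : Type*) := S × Bool

/-- The binary response as a number in `{0, 1}`. -/
def resp (y : Bool) : ℝ := if y then 1 else 0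

/-- `p` is the regression function of the population `P`: `p(X) = P(Y = 1 | X)`. -/
structure IsRegressionFunction {S : Type*} [MeasurableSpace S] (P : Measure (Obs S))
    (p : S → ℝ) : Prop where
  measurable : Measurable p
  condExp_eq : P[fun z => resp z.2 | MeasurableSpace.comap Prod.fst inferInstance]
    =ᵐ[P] fun z => p z.1

/-- I.i.d. observations from the population `P`; for every `n` the first `n` of them are split,
by a random bijection independent of them, into a training set of size `n₁ n` and a test set of
size `n₂ n` (so that `n₁ n + n₂ n = n`). The law of the split is arbitrary: a uniformly random and
a deterministic split are both covered. -/
structure SplitSample {Ω S : Type*} [MeasurableSpace Ω] [MeasurableSpace S]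
    (μ : Measure Ω) (P : Measure (Obs S)) (n₁ n₂ : ℕ → ℕ) where
  obs : ℕ → Ω → Obs S
  measurable_obs : ∀ i, Measurable (obs i)
  law_obs : ∀ i, μ.map (obs i) = P
  indep_obs : iIndepFun obs μ
  split : ∀ n, Ω → Fin (n₁ n) ⊕ Fin (n₂ n) → Fin n
  measurable_split : ∀ n, Measurable (split n)
  bijective_split : ∀ n ω, Function.Bijective (split n ω)
  indep_split : ∀ n, IndepFun (split n) (fun ω (i : Fin n) => obs i ω) μ

namespace SplitSample

variable {Ω S : Type*} [MeasurableSpace Ω] [MeasurableSpace S]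
  {μ : Measure Ω} {P : Measure (Obs S)} {n₁ n₂ : ℕ → ℕ}

/-- The training data. -/
def train (D : SplitSample μ P n₁ n₂) (n : ℕ) (ω : Ω) : Fin (n₁ n) → Obs S :=
  fun i => D.obs (D.split n ω (Sum.inl i)) ω

/-- The test data. -/
def test (D : SplitSample μ P n₁ n₂) (n : ℕ) (ω : Ω) : Fin (n₂ n) → Obs S :=
  fun i => D.obs (D.split n ω (Sum.inr i)) ω

end SplitSample

/-- The fitting procedure of the model to assess: a data set of any size `m` is turned into
a fitted regression function. -/
structure Estimator (S : Type*) [MeasurableSpace S] where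
  fit : ∀ m : ℕ, (Fin m → Obs S) → S → ℝ
  measurable_fit : ∀ m, Measurable fun q : (Fin m → Obs S) × S => fit m q.1 q.2

/-- An adaptive grouping: a partition of the covariate space into `K` groups which is a
function of the training data. -/
structure Grouping (S : Type*) [MeasurableSpace S] (K : ℕ) (n₁ : ℕ → ℕ) where
  group : ∀ n : ℕ, (Fin (n₁ n) → Obs S) → Fin K → Set S
  measurable_group : ∀ n k,
    MeasurableSet {q : (Fin (n₁ n) → Obs S) × S | q.2 ∈ group n q.1 k}
  disjoint_group : ∀ n d k l, k ≠ l → Disjoint (group n d k) (group n d l)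
  cover_group : ∀ n d, ⋃ k, group n d k = Set.univ

open Classical in
/-- The number of test observations whose covariates fall in `G`. -/
noncomputable def groupCount {S : Type*} {m : ℕ} (G : Set S) (T : Fin m → Obs S) : ℕ :=
  (Finset.univ.filter fun i => (T i).1 ∈ G).card

open Classical in
/-- The statistic `∑_k (∑_{i : x_i ∈ G_k} R_i / √(∑_{i : x_i ∈ G_k} σ_i²))²`, where
`R_i = y_i - q(x_i)` and `σ_i² = q(x_i) (1 - q(x_i))`, for a fitted regression function `q`, groups
`G_k` and test data `T`. -/
noncomputable def bagStat {S : Type*} {K m : ℕ} (q : S → ℝ) (G : Fin K → Set S)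
    (T : Fin m → Obs S) : ℝ :=
  ∑ k, ((∑ i with (T i).1 ∈ G k, (resp (T i).2 - q (T i).1)) /
    √(∑ i with (T i).1 ∈ G k, q (T i).1 * (1 - q (T i).1))) ^ 2

/-- The BAG statistic of the split sample `D`, for the total sample size `n`. -/
noncomputable def BAG {Ω S : Type*} [MeasurableSpace Ω] [MeasurableSpace S]
    {μ : Measure Ω} {P : Measure (Obs S)} {n₁ n₂ : ℕ → ℕ} {K : ℕ}
    (D : SplitSample μ P n₁ n₂) (E : Estimator S) (G : Grouping S K n₁) (n : ℕ) (ω : Ω) : ℝ :=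
  bagStat (E.fit (n₁ n) (D.train n ω)) (G.group n (D.train n ω)) (D.test n ω)

/-- The chi-squared distribution with `K` degrees of freedom: the law of the sum of the squares of
`K` independent standard Gaussian variables. -/
noncomputable def chiSquared (K : ℕ) : Measure ℝ :=
  (Measure.pi fun _ : Fin K => gaussianReal 0 1).map fun z => ∑ k, z k ^ 2

instance chiSquared_isProbabilityMeasure (K : ℕ) : IsProbabilityMeasure (chiSquared K) := by
  unfold chiSquared
  have h : Measurable fun z : Fin K → ℝ => ∑ k, z k ^ 2 := by fun_prop
  exact Measure.isProbabilityMeasure_map h.aemeasurable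

/-- Convergence to `∞` in probability. -/
def TendstoInftyInProb {Ω : Type*} [MeasurableSpace Ω] (μ : Measure Ω) (V : ℕ → Ω → ℝ) : Prop :=
  ∀ M : ℝ, Tendsto (fun n => μ {ω | V n ω ≤ M}) atTop (𝓝 0)

/-- `sup_x |p̂_{D_m}(x) - f(x)| = O_p(r_m)` as `m → ∞`, where `D_m` consists of `m` i.i.d.
observations from `P`. (If the supremum is not measurable, outer probability is used.) -/
def SupErrorBigOInProb {S : Type*} [MeasurableSpace S] (P : Measure (Obs S)) (E : Estimator S)
    (f : S → ℝ) (r : ℕ → ℝ) : Prop :=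
  ∀ ε : ℝ≥0∞, 0 < ε → ∃ C : ℝ, 0 < C ∧ ∀ᶠ m in atTop,
    Measure.pi (fun _ : Fin m => P)
      {d | ENNReal.ofReal (C * r m) < ⨆ x, ENNReal.ofReal |E.fit m d x - f x|} ≤ ε

/-- Sufficient sample size for each group: for each `k`, the number `N_k` of test observations in
group `k` tends to infinity in probability at the rate `n₂`, i.e. `n₂ / N_k` is stochastically
bounded. -/
def SufficientGroupSize {Ω S : Type*} [MeasurableSpace Ω] [MeasurableSpace S]
    {μ : Measure Ω} {P : Measure (Obs S)} {n₁ n₂ : ℕ → ℕ} {K : ℕ}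
    (D : SplitSample μ P n₁ n₂) (G : Grouping S K n₁) : Prop :=
  ∀ k : Fin K, ∀ ε : ℝ≥0∞, 0 < ε → ∃ c : ℝ, 0 < c ∧ ∀ᶠ n in atTop,
    μ {ω | (groupCount (G.group n (D.train n ω) k) (D.test n ω) : ℝ) < c * n₂ n} ≤ ε

/-- Bounded probability: `c₂ ≤ p(X) ≤ 1 - c₂` almost surely, for some `0 < c₂ < 1/2`. -/
def BoundedProbability {S : Type*} [MeasurableSpace S] (P : Measure (Obs S)) (p : S → ℝ) : Prop :=
  ∃ c₂ : ℝ, 0 < c₂ ∧ c₂ < 1 / 2 ∧ ∀ᵐ z ∂P, c₂ ≤ p z.1 ∧ p z.1 ≤ 1 - c₂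

/-- Convergence of the predicted probability to the true regression function, at the rate `r`. -/
def ConvergenceUnderNull {S : Type*} [MeasurableSpace S] (P : Measure (Obs S)) (E : Estimator S)
    (p : S → ℝ) (r : ℕ → ℝ) : Prop :=
  Tendsto r atTop (𝓝 0) ∧ SupErrorBigOInProb P E p r

/-- Convergence of the predicted probability to a function `pa : S → [0, 1]`, at the rate `ra`,
where `pa(X)` is bounded away from `0` and `1`. -/
def ConvergenceUnderAlternative {S : Type*} [MeasurableSpace S] (P : Measure (Obs S))
    (E : Estimator S) (pa : S → ℝ) (ra : ℕ → ℝ) : Prop :=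
  Measurable pa ∧ (∀ x, 0 ≤ pa x ∧ pa x ≤ 1) ∧
  Tendsto ra atTop (𝓝 0) ∧ SupErrorBigOInProb P E pa ra ∧
  ∃ c₃ : ℝ, 0 < c₃ ∧ ∀ᵐ z ∂P, c₃ ≤ pa z.1 ∧ pa z.1 ≤ 1 - c₃

/-- Difference in group-level probability: for some `c₄ > 0`,
`max_k |E[1{x ∈ G_k} (p(x) - pa(x))]| > c₄` with probability tending to one, where the groups `G_k`
are determined by the training data and `E` is over a new observation `x` only. -/
def GroupLevelDifference {Ω S : Type*} [MeasurableSpace Ω] [MeasurableSpace S]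
    {μ : Measure Ω} {P : Measure (Obs S)} {n₁ n₂ : ℕ → ℕ} {K : ℕ}
    (D : SplitSample μ P n₁ n₂) (G : Grouping S K n₁) (p pa : S → ℝ) : Prop :=
  ∃ c₄ : ℝ, 0 < c₄ ∧ Tendsto (fun n => μ {ω | ∃ k : Fin K,
    c₄ < |∫ z, (G.group n (D.train n ω) k).indicator (fun x => p x - pa x) z.1 ∂P|})
    atTop (𝓝 1)

/-- The parametric rate `n^{-1/2}`. -/
noncomputable def parametricRate (n : ℕ) : ℝ := (n : ℝ) ^ (-(1 / 2) : ℝ)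

/-!
The training data `d` and the test data are independent samples from the population, because the
split is independent of the observations (`SplitSample.measurePreserving_train_test`). A test
observation can moreover be generated from its covariate `x` and an independent uniform variable `u`
as `(x, 1{u ≤ p x})`; given the training data and all test covariates, the responses are then
independent Bernoulli variables while the groups are fixed sets. This replaces all conditioning by
Fubini's theorem.

**Null hypothesis.** Let `Z_k` be the sum of the residuals `y_i - p(x_i)` in the `k`-th group,
divided by `√(∑ p(x_i) (1 - p(x_i)))`. Given the training data and the covariates, the
characteristic function of `Z` at `t` is a product of centred Bernoulli characteristic functions.
Comparing each factor with the Gaussian one of the same variance gives exactly `exp (-‖t‖² / 2)` as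
the product, with an error of order `n₂^{-1/2}` when every group contains a fixed fraction of the
test data. Lévy's theorem yields `Z → N(0, I_K)` (`tendstoInDistribution_residualVector`). Replacing
`p` by the fitted function, which is within `C n₁^{-1/2}` of it, moves each coordinate by at most a
multiple of `√(n₂ / n₁)`, deterministically on an event of high probability
(`abs_standardizedSum_sub_le`), so the Slutsky and continuous mapping theorems apply.

**Alternative.** Given the training data, the sum of `1{x_i ∈ G_k} (y_i - pa(x_i))` has mean
`n₂ E[1{x ∈ G_k} (p(x) - pa(x))]` and variance at most `n₂`. By Chebyshev's inequality the sum of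
some group is of order `n₂` with high probability, and so is the corresponding sum of fitted
residuals. As the nominal variance of a group is at most `n₂`, the statistic is at least a multiple
of `n₂` (`le_bagStat`).
-/

/-! ### Bernoulli characteristic functions and standardized sums -/

theorem norm_prod_sub_prod_le_sum {ι : Type*} (s : Finset ι) (a b : ι → ℂ)
    (ha : ∀ i ∈ s, ‖a i‖ ≤ 1) (hb : ∀ i ∈ s, ‖b i‖ ≤ 1) :
    ‖∏ i ∈ s, a i - ∏ i ∈ s, b i‖ ≤ ∑ i ∈ s, ‖a i - b i‖ := by
  classical
  induction s using Finset.induction_on with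
  | empty => simp
  | insert j s hj ih =>
    rw [Finset.prod_insert hj, Finset.prod_insert hj, Finset.sum_insert hj]
    have ih' := ih (fun i hi => ha i (Finset.mem_insert_of_mem hi))
      (fun i hi => hb i (Finset.mem_insert_of_mem hi))
    have hA : ‖∏ i ∈ s, a i‖ ≤ 1 := by
      rw [norm_prod]
      exact Finset.prod_le_one (fun i _ => norm_nonneg _)
        fun i hi => ha i (Finset.mem_insert_of_mem hi)
    have e : a j * ∏ i ∈ s, a i - b j * ∏ i ∈ s, b i =
        (a j - b j) * ∏ i ∈ s, a i + b j * (∏ i ∈ s, a i - ∏ i ∈ s, b i) := by ring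
    rw [e]
    refine (norm_add_le _ _).trans ?_
    rw [norm_mul, norm_mul]
    have h1 := mul_le_mul_of_nonneg_left hA (norm_nonneg (a j - b j))
    have h2 := mul_le_mul_of_nonneg_right (hb j (Finset.mem_insert_self j s))
      (norm_nonneg (∏ i ∈ s, a i - ∏ i ∈ s, b i))
    linarith

/-- The characteristic function at `a` of `Y - p`, for a Bernoulli variable `Y` with success
probability `p`. -/
noncomputable def centeredBernoulliCharFun (p a : ℝ) : ℂ :=
  p * Complex.exp ((a * (1 - p) : ℝ) * Complex.I) +
    (1 - p) * Complex.exp ((a * (0 - p) : ℝ) * Complex.I)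

theorem norm_centeredBernoulliCharFun_le_one {p : ℝ} (h0 : 0 ≤ p) (h1 : p ≤ 1) (a : ℝ) :
    ‖centeredBernoulliCharFun p a‖ ≤ 1 := by
  unfold centeredBernoulliCharFun
  refine (norm_add_le _ _).trans ?_
  have e : ‖(1 - p : ℂ)‖ = 1 - p := by
    rw [← Complex.ofReal_one, ← Complex.ofReal_sub, Complex.norm_real, Real.norm_eq_abs,
      abs_of_nonneg (by linarith)]
  rw [norm_mul, norm_mul, Complex.norm_exp_ofReal_mul_I, Complex.norm_exp_ofReal_mul_I,
    Complex.norm_real, Real.norm_eq_abs, abs_of_nonneg h0, e]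
  linarith

theorem norm_exp_ofReal_mul_I_sub_le {x : ℝ} (hx : |x| ≤ 1) :
    ‖Complex.exp (x * Complex.I) - (1 + x * Complex.I - x ^ 2 / 2)‖ ≤ |x| ^ 3 := by
  have hn : ‖(x : ℂ) * Complex.I‖ = |x| := by simp
  have h := Complex.exp_bound (x := x * Complex.I) (by rw [hn]; exact hx) (n := 3) (by norm_num)
  have e : ∑ m ∈ Finset.range 3, ((x : ℂ) * Complex.I) ^ m / (m.factorial : ℂ) =
      1 + x * Complex.I - x ^ 2 / 2 := by
    simp [Finset.sum_range_succ, Nat.factorial, mul_pow]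
    ring
  rw [e, hn] at h
  refine h.trans ?_
  have : (0 : ℝ) ≤ |x| ^ 3 := by positivity
  norm_num [Nat.factorial]
  nlinarith

/-- Third-order comparison of the centred Bernoulli characteristic function with that of the
Gaussian of the same variance. -/
theorem norm_centeredBernoulliCharFun_sub_exp_le {p a : ℝ} (h0 : 0 ≤ p) (h1 : p ≤ 1)
    (ha : |a| ≤ 1) :
    ‖centeredBernoulliCharFun p a - Complex.exp ((-(a ^ 2 * (p * (1 - p)) / 2) : ℝ))‖ ≤
      2 * |a| ^ 3 := by
  have ha0 := abs_nonneg a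
  have hx1 : |a * (1 - p)| ≤ |a| := by
    rw [abs_mul, abs_of_nonneg (by linarith : 0 ≤ 1 - p)]
    nlinarith
  have hx2 : |a * (0 - p)| ≤ |a| := by
    rw [abs_mul, zero_sub, abs_neg, abs_of_nonneg h0]
    nlinarith
  have b1 := (norm_exp_ofReal_mul_I_sub_le (hx1.trans ha)).trans
    (pow_le_pow_left₀ (abs_nonneg _) hx1 3)
  have b2 := (norm_exp_ofReal_mul_I_sub_le (hx2.trans ha)).trans
    (pow_le_pow_left₀ (abs_nonneg _) hx2 3)
  have hpq : 0 ≤ p * (1 - p) := mul_nonneg h0 (by linarith)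
  have hpq4 : p * (1 - p) ≤ 1 / 4 := by nlinarith [sq_nonneg (p - 1 / 2)]
  set y : ℝ := a ^ 2 * (p * (1 - p)) / 2 with hy
  have ha2 : a ^ 2 ≤ 1 := by rw [← sq_abs]; nlinarith
  have hy0 : 0 ≤ y := by positivity
  have hy1 : y ≤ a ^ 2 / 8 := by rw [hy]; nlinarith [sq_nonneg a]
  have b3 : |Real.exp (-y) - (1 - y)| ≤ |a| ^ 3 := by
    have := Real.abs_exp_sub_one_sub_id_le (x := -y) (by rw [abs_neg, abs_of_nonneg hy0]; linarith)
    have e : Real.exp (-y) - (1 - y) = Real.exp (-y) - 1 - -y := by ring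
    rw [e]
    refine this.trans ?_
    have h3 : (-y) ^ 2 ≤ (a ^ 2 / 8) ^ 2 := by
      rw [neg_sq]; exact pow_le_pow_left₀ hy0 hy1 2
    refine h3.trans ?_
    rw [← sq_abs a]
    have : |a| ^ 4 ≤ |a| ^ 3 := pow_le_pow_of_le_one ha0 ha (by norm_num)
    nlinarith [pow_nonneg ha0 4]
  have key : centeredBernoulliCharFun p a - Complex.exp ((-y : ℝ)) =
      p * (Complex.exp ((a * (1 - p) : ℝ) * Complex.I) -
          (1 + (a * (1 - p) : ℝ) * Complex.I - ((a * (1 - p) : ℝ) : ℂ) ^ 2 / 2)) +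
      ((1 - p : ℝ) : ℂ) * (Complex.exp ((a * (0 - p) : ℝ) * Complex.I) -
          (1 + (a * (0 - p) : ℝ) * Complex.I - ((a * (0 - p) : ℝ) : ℂ) ^ 2 / 2)) -
      ((Real.exp (-y) - (1 - y) : ℝ) : ℂ) := by
    unfold centeredBernoulliCharFun
    rw [hy]
    push_cast
    ring
  rw [key]
  refine (norm_sub_le _ _).trans ?_
  have t1 := norm_add_le (p * (Complex.exp ((a * (1 - p) : ℝ) * Complex.I) -
          (1 + (a * (1 - p) : ℝ) * Complex.I - ((a * (1 - p) : ℝ) : ℂ) ^ 2 / 2)))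
      (((1 - p : ℝ) : ℂ) * (Complex.exp ((a * (0 - p) : ℝ) * Complex.I) -
          (1 + (a * (0 - p) : ℝ) * Complex.I - ((a * (0 - p) : ℝ) : ℂ) ^ 2 / 2)))
  rw [norm_mul, norm_mul, Complex.norm_real, Complex.norm_real, Real.norm_eq_abs, Real.norm_eq_abs,
    abs_of_nonneg h0, abs_of_nonneg (by linarith : 0 ≤ 1 - p)] at t1
  have m1 := mul_le_mul_of_nonneg_left b1 h0
  have m2 := mul_le_mul_of_nonneg_left b2 (by linarith : 0 ≤ 1 - p)
  rw [Complex.norm_real, Real.norm_eq_abs]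
  linarith

theorem sq_le_mul_one_sub {c p : ℝ} (hc : 0 ≤ c) (h1 : c ≤ p) (h2 : p ≤ 1 - c) :
    c ^ 2 ≤ p * (1 - p) := by
  nlinarith [mul_le_mul h1 (by linarith : c ≤ 1 - p) hc (by linarith)]

/-- Replacing the probabilities `p i`, bounded away from `0` and `1`, by `δ`-close values `q i`
moves the standardized sum of Bernoulli residuals by at most a multiple of `δ √N`, where `N` is the
number of summands. -/
theorem abs_standardizedSum_sub_le {ι : Type*} (I : Finset ι) (y p q : ι → ℝ) {c δ : ℝ}
    (hc : 0 < c) (hy : ∀ i ∈ I, 0 ≤ y i ∧ y i ≤ 1)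
    (hp : ∀ i ∈ I, c ≤ p i ∧ p i ≤ 1 - c) (hδ : δ ≤ c / 2) (hδ0 : 0 ≤ δ)
    (hq : ∀ i ∈ I, |q i - p i| ≤ δ) :
    |(∑ i ∈ I, (y i - q i)) / √(∑ i ∈ I, q i * (1 - q i)) -
      (∑ i ∈ I, (y i - p i)) / √(∑ i ∈ I, p i * (1 - p i))| ≤
      (2 / c + 2 / c ^ 3) * (√(I.card : ℝ) * δ) := by
  rcases I.eq_empty_or_nonempty with rfl | hI
  · simp
  have hN : (0 : ℝ) < I.card := by exact_mod_cast hI.card_pos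
  set N : ℝ := (I.card : ℝ) with hNdef
  have hqb : ∀ i ∈ I, c / 2 ≤ q i ∧ q i ≤ 1 - c / 2 := fun i hi => by
    have := abs_le.1 (hq i hi); have := hp i hi
    constructor <;> linarith
  have hs : c ^ 2 * N ≤ ∑ i ∈ I, p i * (1 - p i) := by
    rw [hNdef, mul_comm, ← nsmul_eq_mul]
    exact Finset.card_nsmul_le_sum _ _ _ fun i hi => sq_le_mul_one_sub hc.le (hp i hi).1 (hp i hi).2
  have ht : (c / 2) ^ 2 * N ≤ ∑ i ∈ I, q i * (1 - q i) := by
    rw [hNdef, mul_comm, ← nsmul_eq_mul]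
    exact Finset.card_nsmul_le_sum _ _ _
      fun i hi => sq_le_mul_one_sub (by positivity) (hqb i hi).1 (hqb i hi).2
  have hA : |∑ i ∈ I, (y i - p i)| ≤ N := by
    refine (Finset.abs_sum_le_sum_abs _ _).trans ?_
    refine (Finset.sum_le_card_nsmul _ _ 1 fun i hi => ?_).trans_eq (by simp [hNdef])
    have := hp i hi; have := hy i hi
    rw [abs_le]; constructor <;> linarith
  have hB : |∑ i ∈ I, (p i - q i)| ≤ N * δ := by
    refine (Finset.abs_sum_le_sum_abs _ _).trans ?_
    refine (Finset.sum_le_card_nsmul _ _ δ fun i hi => ?_).trans_eq (by simp [hNdef])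
    rw [abs_sub_comm]; exact hq i hi
  have hD : |∑ i ∈ I, p i * (1 - p i) - ∑ i ∈ I, q i * (1 - q i)| ≤ N * δ := by
    rw [← Finset.sum_sub_distrib]
    refine (Finset.abs_sum_le_sum_abs _ _).trans ?_
    refine (Finset.sum_le_card_nsmul _ _ δ fun i hi => ?_).trans_eq (by simp [hNdef])
    have h1 := hp i hi; have h2 := hqb i hi
    have e : p i * (1 - p i) - q i * (1 - q i) = -((q i - p i) * (1 - p i - q i)) := by ring
    rw [e, abs_neg, abs_mul]
    have : |1 - p i - q i| ≤ 1 := by rw [abs_le]; constructor <;> linarith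
    calc _ ≤ |q i - p i| * 1 := by gcongr
      _ ≤ δ := by rw [mul_one]; exact hq i hi
  set s2 := ∑ i ∈ I, p i * (1 - p i)
  set t2 := ∑ i ∈ I, q i * (1 - q i)
  set A := ∑ i ∈ I, (y i - p i) with hAdef
  set B := ∑ i ∈ I, (p i - q i) with hBdef
  have hAB : ∑ i ∈ I, (y i - q i) = A + B := by
    rw [hAdef, hBdef, ← Finset.sum_add_distrib]
    exact Finset.sum_congr rfl fun i _ => by ring
  have hr : 0 < √N := Real.sqrt_pos.2 hN
  have hs' : c * √N ≤ √s2 := by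
    rw [← Real.sqrt_sq hc.le, ← Real.sqrt_mul (sq_nonneg c)]; exact Real.sqrt_le_sqrt hs
  have ht' : c / 2 * √N ≤ √t2 := by
    rw [← Real.sqrt_sq (by positivity : 0 ≤ c / 2), ← Real.sqrt_mul (sq_nonneg _)]
    exact Real.sqrt_le_sqrt ht
  have hs0 : 0 < √s2 := lt_of_lt_of_le (by positivity) hs'
  have ht0 : 0 < √t2 := lt_of_lt_of_le (by positivity) ht'
  have hNr : √N * √N = N := Real.mul_self_sqrt hN.le
  have hNd : N * δ = √N * δ * √N := by linear_combination -δ * hNr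
  have hst : |√s2 - √t2| ≤ √N * δ / c := by
    have e : (√s2 - √t2) * (√s2 + √t2) = s2 - t2 := by
      have a1 := Real.mul_self_sqrt (Real.sqrt_pos.1 hs0).le
      have a2 := Real.mul_self_sqrt (Real.sqrt_pos.1 ht0).le
      linear_combination a1 - a2
    rw [le_div_iff₀ hc]
    have h1 : |√s2 - √t2| * (√s2 + √t2) ≤ N * δ := by
      rw [← abs_of_pos (add_pos hs0 ht0), ← abs_mul, e]; exact hD
    have h2 : |√s2 - √t2| * (c * √N) ≤ √N * δ * √N :=
      calc _ ≤ |√s2 - √t2| * (√s2 + √t2) := by gcongr; linarith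
        _ ≤ N * δ := h1
        _ = √N * δ * √N := hNd
    have h3 : |√s2 - √t2| * c * √N ≤ √N * δ * √N := by linarith
    exact le_of_mul_le_mul_right h3 hr
  have e : (A + B) / √t2 - A / √s2 = B / √t2 + A * (√s2 - √t2) / (√s2 * √t2) := by
    field_simp; ring
  rw [hAB, e]
  refine (abs_add_le _ _).trans ?_
  have f1 : |B / √t2| ≤ 2 / c * (√N * δ) := by
    rw [abs_div, abs_of_pos ht0]
    calc |B| / √t2 ≤ (N * δ) / (c / 2 * √N) := by gcongr
      _ = 2 / c * (√N * δ) := by rw [hNd]; field_simp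
  have f2 : |A * (√s2 - √t2) / (√s2 * √t2)| ≤ 2 / c ^ 3 * (√N * δ) := by
    rw [abs_div, abs_mul, abs_of_pos (mul_pos hs0 ht0)]
    calc |A| * |√s2 - √t2| / (√s2 * √t2)
        ≤ N * (√N * δ / c) / ((c * √N) * (c / 2 * √N)) := by gcongr
      _ = N * (√N * δ / c) / (c ^ 2 / 2 * N) := by
        congr 1; linear_combination c ^ 2 / 2 * hNr
      _ = 2 / c ^ 3 * (√N * δ) := by field_simp
  linarith

/-! ### Laws of the training and the test data -/

section RandomSplit

variable {Ω S : Type*} [MeasurableSpace Ω] [MeasurableSpace S]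

/-- An i.i.d. sample read through an independent random injection `σ` into its index set is again
i.i.d. with the same law, since this holds for every fixed value of `σ`. -/
theorem map_comp_indep_injection {ι : Type*} [Fintype ι] {α : Type*} [MeasurableSpace α]
    {μ : Measure Ω} [IsProbabilityMeasure μ] {P : Measure α} [IsProbabilityMeasure P]
    {n : ℕ} {X : Fin n → Ω → α}
    (hX : ∀ i, Measurable (X i)) (hlaw : ∀ i, μ.map (X i) = P) (hindep : iIndepFun X μ)
    {σ : Ω → ι → Fin n} (hσ : Measurable σ) (hinj : ∀ ω, Function.Injective (σ ω))
    (hσX : IndepFun σ (fun ω i => X i ω) μ) :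
    MeasurePreserving (fun ω j => X (σ ω j) ω) μ (Measure.pi fun _ : ι => P) := by
  classical
  have hmeas : Measurable fun ω j => X (σ ω j) ω := by
    refine measurable_pi_lambda _ fun j => ?_
    have h : Measurable fun q : Fin n × Ω => X q.1 q.2 :=
      measurable_from_prod_countable_right fun i => hX i
    exact h.comp (((measurable_pi_apply j).comp hσ).prodMk measurable_id)
  refine ⟨hmeas, Measure.ext fun A hA => ?_⟩
  rw [Measure.map_apply hmeas hA]
  have hfix : ∀ τ : ι → Fin n, Function.Injective τ →
      μ ((fun ω j => X (τ j) ω) ⁻¹' A) = Measure.pi (fun _ : ι => P) A := by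
    intro τ hτ
    rw [← Measure.map_apply (measurable_pi_lambda _ fun j => hX (τ j)) hA,
      (hindep.precomp hτ).map_fun_eq_pi_map fun j => (hX (τ j)).aemeasurable]
    simp only [hlaw]
  have hpiece : ∀ τ : ι → Fin n,
      μ.restrict ((fun ω j => X (σ ω j) ω) ⁻¹' A) (σ ⁻¹' {τ}) =
        μ (σ ⁻¹' {τ}) * Measure.pi (fun _ : ι => P) A := by
    intro τ
    have hτm : MeasurableSet (σ ⁻¹' {τ}) := hσ (measurableSet_singleton τ)
    rw [Measure.restrict_apply hτm]
    by_cases hτ : Function.Injective τ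
    · have hA' : MeasurableSet {x : Fin n → α | (fun j => x (τ j)) ∈ A} :=
        (measurable_pi_lambda _ fun j => measurable_pi_apply (τ j)) hA
      have := hσX.measure_inter_preimage_eq_mul {τ} _ (measurableSet_singleton τ) hA'
      rw [← hfix τ hτ]
      refine Eq.trans (congrArg μ ?_) this
      ext ω
      simp only [Set.mem_inter_iff, Set.mem_preimage, Set.mem_singleton_iff, Set.mem_ofPred_eq]
      constructor
      · rintro ⟨rfl, h⟩; exact ⟨rfl, h⟩
      · rintro ⟨rfl, h⟩; exact ⟨rfl, h⟩
    · have : σ ⁻¹' {τ} = ∅ := by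
        ext ω
        simp only [Set.mem_preimage, Set.mem_singleton_iff, Set.mem_empty_iff_false, iff_false]
        rintro rfl; exact hτ (hinj ω)
      simp [this]
  have hsum := sum_measure_preimage_singleton
    (μ := μ.restrict ((fun ω j => X (σ ω j) ω) ⁻¹' A)) (Finset.univ : Finset (ι → Fin n))
    (f := σ) fun τ _ => hσ (measurableSet_singleton τ)
  have hsum' := sum_measure_preimage_singleton
    (μ := μ) (Finset.univ : Finset (ι → Fin n)) (f := σ) fun τ _ => hσ (measurableSet_singleton τ)
  simp only [hpiece, ← Finset.sum_mul, hsum'] at hsum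
  simpa using hsum.symm

/-- The training and the test data are independent samples from the population. -/
theorem SplitSample.measurePreserving_train_test {μ : Measure Ω} [IsProbabilityMeasure μ]
    {P : Measure (Obs S)} [IsProbabilityMeasure P] {n₁ n₂ : ℕ → ℕ}
    (D : SplitSample μ P n₁ n₂) (n : ℕ) :
    MeasurePreserving (fun ω => (D.train n ω, D.test n ω)) μ
      ((Measure.pi fun _ : Fin (n₁ n) => P).prod (Measure.pi fun _ : Fin (n₂ n) => P)) := by
  have h := map_comp_indep_injection (X := fun (i : Fin n) => D.obs i)
    (fun i => D.measurable_obs i) (fun i => D.law_obs i)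
    (D.indep_obs.precomp Fin.val_injective) (D.measurable_split n)
    (fun ω => (D.bijective_split n ω).1) (D.indep_split n)
  exact (measurePreserving_sumPiEquivProdPi (X := fun _ => Obs S)
    (fun _ : Fin (n₁ n) ⊕ Fin (n₂ n) => P)).comp h

end RandomSplit

/-! ### The regression function and the uniform representation of the responses -/

section Regression

theorem IsRegressionFunction.integrable {S : Type*} [MeasurableSpace S] {P : Measure (Obs S)}
    {p : S → ℝ} (hp : IsRegressionFunction P p) : Integrable (fun z : Obs S => p z.1) P :=
  integrable_condExp.congr hp.condExp_eq

variable {S : Type*} [MeasurableSpace S] {P : Measure (Obs S)} [IsProbabilityMeasure P] {p : S → ℝ}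

theorem measurable_resp : Measurable resp := measurable_of_countable _

theorem resp_mem_Icc (b : Bool) : 0 ≤ resp b ∧ resp b ≤ 1 := by
  cases b <;> simp [resp]

theorem integrable_resp : Integrable (fun z : Obs S => resp z.2) P :=
  Integrable.of_bound (measurable_resp.comp measurable_snd).aestronglyMeasurable 1
    (ae_of_all _ fun z => by
      rw [Real.norm_eq_abs, abs_of_nonneg (resp_mem_Icc _).1]; exact (resp_mem_Icc _).2)

theorem IsRegressionFunction.setIntegral_eq (hp : IsRegressionFunction P p) {A : Set S}
    (hA : MeasurableSet A) :
    ∫ z in Prod.fst ⁻¹' A, p z.1 ∂P = ∫ z in Prod.fst ⁻¹' A, resp z.2 ∂P := by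
  have hm : MeasurableSpace.comap (Prod.fst : Obs S → S) inferInstance ≤
    (inferInstance : MeasurableSpace (Obs S)) := measurable_fst.comap_le
  have hA' : MeasurableSet[MeasurableSpace.comap (Prod.fst : Obs S → S) inferInstance]
      (Prod.fst ⁻¹' A) := ⟨A, hA, rfl⟩
  rw [← setIntegral_condExp hm integrable_resp hA']
  exact setIntegral_congr_ae (measurable_fst hA) (hp.condExp_eq.mono fun z hz _ => hz.symm)

/-- A population observation is obtained from a covariate value `x` and an independent uniform
variable `u` as `(x, 1{u ≤ p x})`. -/
noncomputable def bernoulliObs (p : S → ℝ) (q : S × ℝ) : Obs S :=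
  open Classical in (q.1, decide (q.2 ≤ p q.1))

theorem measurable_bernoulliObs (hp : Measurable p) : Measurable (bernoulliObs p) := by
  refine measurable_fst.prodMk ?_
  refine measurable_to_bool ?_
  have : (fun q : S × ℝ => open Classical in decide (q.2 ≤ p q.1)) ⁻¹' {true} =
      {q | q.2 ≤ p q.1} := by ext; simp
  rw [this]
  exact measurableSet_le measurable_snd (hp.comp measurable_fst)

/-- The uniform distribution on `[0, 1]`. -/
noncomputable abbrev unif : Measure ℝ := volume.restrict (Set.Icc 0 1)

instance : IsProbabilityMeasure unif := ⟨by simp [unif]⟩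

theorem unif_Iic {t : ℝ} (h1 : t ≤ 1) : unif {u | u ≤ t} = ENNReal.ofReal t := by
  rw [unif, Measure.restrict_apply (s := Set.Icc 0 1) (t := {u : ℝ | u ≤ t}) measurableSet_Iic]
  have : {u : ℝ | u ≤ t} ∩ Set.Icc 0 1 = Set.Icc 0 t := by
    ext u; simp only [Set.mem_inter_iff, Set.mem_ofPred_eq, Set.mem_Icc]
    constructor
    · rintro ⟨a, b, c⟩; exact ⟨b, a⟩
    · rintro ⟨a, b⟩; exact ⟨b, a, b.trans h1⟩
  rw [this, Real.volume_Icc, sub_zero]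

/-- The pair `(x, 1{u ≤ p x})` has the law of the population: both laws have the same first marginal
and agree on the rectangles `A × {true}`. -/
theorem IsRegressionFunction.measurePreserving_bernoulliObs (hp : IsRegressionFunction P p)
    (hp01 : ∀ᵐ z ∂P, 0 ≤ p z.1 ∧ p z.1 ≤ 1) :
    MeasurePreserving (bernoulliObs p) ((P.map Prod.fst).prod unif) P := by
  have hg := measurable_bernoulliObs hp.measurable
  have : IsProbabilityMeasure (P.map Prod.fst) :=
    Measure.isProbabilityMeasure_map measurable_fst.aemeasurable
  have : IsProbabilityMeasure (((P.map Prod.fst).prod unif).map (bernoulliObs p)) :=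
    Measure.isProbabilityMeasure_map hg.aemeasurable
  have hp01' : ∀ᵐ x ∂(P.map Prod.fst), 0 ≤ p x ∧ p x ≤ 1 := by
    rw [ae_map_iff measurable_fst.aemeasurable]
    · exact hp01
    · exact (measurableSet_le measurable_const hp.measurable).inter
        (measurableSet_le hp.measurable measurable_const)
  have htrue : ∀ A : Set S, MeasurableSet A →
      ((P.map Prod.fst).prod unif).map (bernoulliObs p) (A ×ˢ {true}) = P (A ×ˢ {true}) := by
    intro A hA
    have hAm : MeasurableSet (A ×ˢ ({true} : Set Bool)) := hA.prod (measurableSet_singleton _)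
    rw [Measure.map_apply hg hAm, Measure.prod_apply (hg hAm)]
    have h1 : ∀ᵐ x ∂(P.map Prod.fst),
        unif (Prod.mk x ⁻¹' (bernoulliObs p ⁻¹' (A ×ˢ {true}))) =
          A.indicator (fun x => ENNReal.ofReal (p x)) x := by
      filter_upwards [hp01'] with x hx
      by_cases hxA : x ∈ A
      · rw [Set.indicator_of_mem hxA, ← unif_Iic hx.2]
        congr 1; ext u; simp [bernoulliObs, hxA]
      · rw [Set.indicator_of_notMem hxA]
        have : (Prod.mk x ⁻¹' (bernoulliObs p ⁻¹' (A ×ˢ {true}))) = ∅ := by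
          ext u; simp [bernoulliObs, hxA]
        rw [this, measure_empty]
    rw [lintegral_congr_ae h1, lintegral_indicator hA,
      setLIntegral_map (f := fun x => ENNReal.ofReal (p x)) hA hp.measurable.ennreal_ofReal
        measurable_fst,
      ← ofReal_integral_eq_lintegral_ofReal hp.integrable.integrableOn
        (ae_restrict_of_ae (hp01.mono fun z hz => hz.1)), hp.setIntegral_eq hA]
    have h2 : (fun z : Obs S => resp z.2) = Set.indicator (Prod.snd ⁻¹' {true}) 1 := by
      funext z
      rcases z with ⟨x, b⟩
      cases b <;> simp [resp]
    rw [h2, integral_indicator_one (measurable_snd (measurableSet_singleton _)),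
      measureReal_def, ENNReal.ofReal_toReal (measure_ne_top _ _),
      Measure.restrict_apply (measurable_snd (measurableSet_singleton _)), Set.inter_comm]
    rfl
  have huniv : ∀ A : Set S, MeasurableSet A →
      ((P.map Prod.fst).prod unif).map (bernoulliObs p) (A ×ˢ Set.univ) = P (A ×ˢ Set.univ) := by
    intro A hA
    rw [Measure.map_apply hg (hA.prod MeasurableSet.univ)]
    have : bernoulliObs p ⁻¹' (A ×ˢ Set.univ) = A ×ˢ Set.univ := by
      ext q; simp only [bernoulliObs, Set.mem_preimage, Set.mem_prod, Set.mem_univ]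
    rw [this, Measure.prod_prod, measure_univ, mul_one, Measure.map_apply measurable_fst hA,
      Set.prod_univ]
  have hcount : ∀ Q : Measure (Obs S), IsProbabilityMeasure Q → ∀ A : Set S, MeasurableSet A →
      Q (A ×ˢ {false}) = Q (A ×ˢ Set.univ) - Q (A ×ˢ {true}) := by
    intro Q _ A hA
    rw [← measure_sdiff (Set.prod_mono le_rfl (Set.subset_univ _))
      (hA.prod (measurableSet_singleton _)).nullMeasurableSet (measure_ne_top _ _)]
    congr 1
    ext ⟨x, b⟩
    cases b <;> simp
  refine ⟨hg, ext_of_generate_finite _ generateFrom_prod.symm isPiSystem_prod ?_ (by simp)⟩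
  rintro _ ⟨A, hA, B, -, rfl⟩
  have hfalse : ((P.map Prod.fst).prod unif).map (bernoulliObs p) (A ×ˢ {false}) =
      P (A ×ˢ {false}) := by
    rw [hcount _ inferInstance A hA, hcount P inferInstance A hA, huniv A hA, htrue A hA]
  by_cases ht : true ∈ B <;> by_cases hf : false ∈ B
  · have : B = Set.univ := by ext b; cases b <;> simp [ht, hf]
    rw [this]; exact huniv A hA
  · have : B = {true} := by ext b; cases b <;> simp [ht, hf]
    rw [this]; exact htrue A hA
  · have : B = {false} := by ext b; cases b <;> simp [ht, hf]
    rw [this]; exact hfalse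
  · have : B = ∅ := by ext b; cases b <;> simp [ht, hf]
    simp [this]

/-- Test data from `P`, independent of `q.1.1`, are generated from the covariates `q.1.2` and the
independent uniform variables `q.2`. -/
theorem IsRegressionFunction.measurePreserving_bernoulliSample (hp : IsRegressionFunction P p)
    (hp01 : ∀ᵐ z ∂P, 0 ≤ p z.1 ∧ p z.1 ≤ 1) {α : Type*} [MeasurableSpace α] (Q : Measure α)
    [IsProbabilityMeasure Q] (m : ℕ) :
    MeasurePreserving
      (fun q : (α × (Fin m → S)) × (Fin m → ℝ) =>
        (q.1.1, fun i => bernoulliObs p (q.1.2 i, q.2 i)))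
      ((Q.prod (Measure.pi fun _ => P.map Prod.fst)).prod (Measure.pi fun _ => unif))
      (Q.prod (Measure.pi fun _ => P)) := by
  have : IsProbabilityMeasure (P.map Prod.fst) :=
    Measure.isProbabilityMeasure_map measurable_fst.aemeasurable
  have h1 := (measurePreserving_arrowProdEquivProdArrow S ℝ (Fin m)
    (fun _ => P.map Prod.fst) (fun _ => unif)).symm
  have h2 := measurePreserving_pi (fun _ : Fin m => (P.map Prod.fst).prod unif) (fun _ => P)
    fun _ => hp.measurePreserving_bernoulliObs hp01
  exact ((MeasurePreserving.id Q).prod (h2.comp h1)).comp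
    (measurePreserving_prodAssoc Q (Measure.pi fun _ : Fin m => P.map Prod.fst)
      (Measure.pi fun _ : Fin m => unif))

end Regression

/-- The characteristic function of a Bernoulli residual, in the uniform representation. -/
theorem integral_exp_bernoulliObs {S : Type*} {p : S → ℝ} {x : S} (h0 : 0 ≤ p x)
    (h1 : p x ≤ 1) (a : ℝ) :
    ∫ u, Complex.exp ((a * (resp (bernoulliObs p (x, u)).2 - p x) : ℝ) * Complex.I) ∂unif =
      centeredBernoulliCharFun (p x) a := by
  classical
  have hm : MeasurableSet {u : ℝ | u ≤ p x} := measurableSet_Iic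
  have e : ∀ u : ℝ, Complex.exp ((a * (resp (bernoulliObs p (x, u)).2 - p x) : ℝ) * Complex.I) =
      {u : ℝ | u ≤ p x}.indicator
        (fun _ => Complex.exp ((a * (1 - p x) : ℝ) * Complex.I)) u +
      {u : ℝ | u ≤ p x}ᶜ.indicator
        (fun _ => Complex.exp ((a * (0 - p x) : ℝ) * Complex.I)) u := by
    intro u
    by_cases hu : u ≤ p x
    · simp [bernoulliObs, hu, resp, Set.indicator]
    · simp [bernoulliObs, hu, resp, Set.indicator]
  have hr : unif.real {u | u ≤ p x} = p x := by
    rw [measureReal_def, unif_Iic h1, ENNReal.toReal_ofReal h0]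
  simp only [e]
  rw [integral_add ((integrable_const _).indicator hm) ((integrable_const _).indicator hm.compl),
    integral_indicator_const _ hm, integral_indicator_const _ hm.compl, probReal_compl_eq_one_sub hm,
    hr]
  simp [centeredBernoulliCharFun]

/-! ### Standardized residuals of the groups -/

section StandardizedResidual

variable {S : Type*} {K m : ℕ}

open Classical in
/-- The sum of the residuals `y_i - q(x_i)` over the test observations in the `k`-th group, divided
by its nominal standard deviation. -/
noncomputable def standardizedResidual (q : S → ℝ) (G : Fin K → Set S) (T : Fin m → Obs S)
    (k : Fin K) : ℝ :=
  (∑ i with (T i).1 ∈ G k, (resp (T i).2 - q (T i).1)) /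
    √(∑ i with (T i).1 ∈ G k, q (T i).1 * (1 - q (T i).1))

theorem bagStat_eq_sum_sq (q : S → ℝ) (G : Fin K → Set S) (T : Fin m → Obs S) :
    bagStat q G T = ∑ k, standardizedResidual q G T k ^ 2 := rfl

variable {α : Type*} [MeasurableSpace α] [MeasurableSpace S]

theorem measurable_standardizedResidual {f : α → S → ℝ}
    (hf : Measurable fun q : α × S => f q.1 q.2) {G : α → Fin K → Set S} {k : Fin K}
    (hG : MeasurableSet {q : α × S | q.2 ∈ G q.1 k}) :
    Measurable fun q : α × (Fin m → Obs S) => standardizedResidual (f q.1) (G q.1) q.2 k := by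
  unfold standardizedResidual
  simp only [Finset.sum_filter]
  have hx : ∀ i : Fin m, Measurable fun q : α × (Fin m → Obs S) => (q.1, (q.2 i).1) := fun i => by
    fun_prop
  have hfi : ∀ i : Fin m, Measurable fun q : α × (Fin m → Obs S) => f q.1 (q.2 i).1 :=
    fun i => hf.comp (hx i)
  have hy : ∀ i : Fin m, Measurable fun q : α × (Fin m → Obs S) => resp (q.2 i).2 :=
    fun i => measurable_resp.comp (by fun_prop)
  have hs : ∀ i : Fin m, MeasurableSet {q : α × (Fin m → Obs S) | (q.2 i).1 ∈ G q.1 k} :=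
    fun i => hx i hG
  refine Measurable.div (Finset.measurable_fun_sum _ fun i _ => ?_)
    (Real.continuous_sqrt.measurable.comp (Finset.measurable_fun_sum _ fun i _ => ?_))
  · exact Measurable.ite (hs i) ((hy i).sub (hfi i)) measurable_const
  · exact Measurable.ite (hs i) ((hfi i).mul (measurable_const.sub (hfi i))) measurable_const

theorem measurable_groupCount {G : α → Fin K → Set S} {k : Fin K}
    (hG : MeasurableSet {q : α × S | q.2 ∈ G q.1 k}) :
    Measurable fun q : α × (Fin m → Obs S) => (groupCount (G q.1 k) q.2 : ℝ) := by
  classical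
  have hx : ∀ i : Fin m, Measurable fun q : α × (Fin m → Obs S) => (q.1, (q.2 i).1) := fun i => by
    fun_prop
  have : (fun q : α × (Fin m → Obs S) => (groupCount (G q.1 k) q.2 : ℝ)) =
      fun q => ∑ i, if (q.2 i).1 ∈ G q.1 k then 1 else 0 := by
    funext q
    rw [groupCount, Finset.card_filter]
    push_cast
    exact Finset.sum_congr rfl fun i _ => by congr
  rw [this]
  exact Finset.measurable_fun_sum _ fun i _ =>
    Measurable.ite (hx i hG) measurable_const measurable_const

theorem measurableSet_exists_groupCount_lt {G : α → Fin K → Set S}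
    (hG : ∀ k, MeasurableSet {q : α × S | q.2 ∈ G q.1 k}) (s : ℝ) :
    MeasurableSet {q : α × (Fin m → Obs S) | ∃ k, (groupCount (G q.1 k) q.2 : ℝ) < s} := by
  rw [show {q : α × (Fin m → Obs S) | ∃ k, (groupCount (G q.1 k) q.2 : ℝ) < s} =
    ⋃ k, {q | (groupCount (G q.1 k) q.2 : ℝ) < s} by ext; simp]
  exact MeasurableSet.iUnion fun k =>
    measurableSet_lt (measurable_groupCount (hG k)) measurable_const

end StandardizedResidual

/-! ### Characteristic function of the standardized residuals -/

section ConditionalCharFun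

variable {S : Type*} {K m : ℕ}

theorem exists_groupIndex {G : Fin K → Set S} (hdisj : ∀ k l, k ≠ l → Disjoint (G k) (G l))
    (hcov : ⋃ k, G k = Set.univ) : ∃ κ : S → Fin K, ∀ x k, x ∈ G k ↔ κ x = k := by
  have h : ∀ x, ∃ k, x ∈ G k := fun x => Set.mem_iUnion.1 (hcov ▸ Set.mem_univ x)
  choose κ hκ using h
  refine ⟨κ, fun x k => ⟨fun hx => ?_, fun hx => hx ▸ hκ x⟩⟩
  by_contra hne
  exact Set.disjoint_left.1 (hdisj _ _ hne) (hκ x) hx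

/-- Given the covariates `x`, the inner product of the vector of standardized residuals with `t` is
a linear combination of the residuals; this is the coefficient of the `i`-th one when `κ` assigns
covariates to groups. -/
noncomputable def residualWeight (p : S → ℝ) (κ : S → Fin K) (t : Fin K → ℝ) (x : Fin m → S)
    (i : Fin m) : ℝ :=
  t (κ (x i)) / √(∑ j with κ (x j) = κ (x i), p (x j) * (1 - p (x j)))

theorem sum_standardizedResidual_mul {p : S → ℝ} {G : Fin K → Set S} {κ : S → Fin K}
    (hκ : ∀ x k, x ∈ G k ↔ κ x = k) (t : Fin K → ℝ) (T : Fin m → Obs S) :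
    ∑ k, standardizedResidual p G T k * t k =
      ∑ i, residualWeight p κ t (fun j => (T j).1) i * (resp (T i).2 - p (T i).1) := by
  rw [← Finset.sum_fiberwise Finset.univ (fun i => κ (T i).1)]
  refine Finset.sum_congr rfl fun k _ => ?_
  unfold standardizedResidual
  simp only [hκ]
  rw [div_mul_eq_mul_div, mul_comm, mul_div_right_comm, Finset.mul_sum]
  refine Finset.sum_congr (by congr) fun i hi => ?_
  have hk : κ (T i).1 = k := by simpa using hi
  simp only [residualWeight, hk]

/-- Conditionally on the covariates the residuals are independent, so the characteristic function of
the vector of standardized residuals is a product of centred Bernoulli characteristic functions. -/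
theorem integral_exp_standardizedResidual {p : S → ℝ} {G : Fin K → Set S} {κ : S → Fin K}
    (hκ : ∀ x k, x ∈ G k ↔ κ x = k) (t : Fin K → ℝ) {x : Fin m → S}
    (hx : ∀ i, 0 ≤ p (x i) ∧ p (x i) ≤ 1) :
    ∫ u, Complex.exp ((∑ k, standardizedResidual p G (fun i => bernoulliObs p (x i, u i)) k * t k :
      ℝ) * Complex.I) ∂(Measure.pi fun _ : Fin m => unif) =
      ∏ i, centeredBernoulliCharFun (p (x i)) (residualWeight p κ t x i) := by
  simp only [sum_standardizedResidual_mul hκ]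
  have e : ∀ u : Fin m → ℝ, Complex.exp ((∑ i, residualWeight p κ t
      (fun j => (bernoulliObs p (x j, u j)).1) i *
        (resp (bernoulliObs p (x i, u i)).2 - p (bernoulliObs p (x i, u i)).1) : ℝ) * Complex.I) =
      ∏ i, Complex.exp ((residualWeight p κ t x i *
        (resp (bernoulliObs p (x i, u i)).2 - p (x i)) : ℝ) * Complex.I) := by
    intro u
    rw [← Complex.exp_sum, ← Finset.sum_mul, ← Complex.ofReal_sum]
    rfl
  simp only [e]
  rw [integral_fintype_prod_eq_prod (f := fun i v => Complex.exp ((residualWeight p κ t x i *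
    (resp (bernoulliObs p (x i, v)).2 - p (x i)) : ℝ) * Complex.I))]
  exact Finset.prod_congr rfl fun i _ => integral_exp_bernoulliObs (hx i).1 (hx i).2 _

/-- When every group has at least `b m` of the `m` observations, the conditional characteristic
function is within `O(m^{-1/2})` of the standard Gaussian one. -/
theorem norm_prod_centeredBernoulliCharFun_sub_le {p : S → ℝ} {κ : S → Fin K} {t : Fin K → ℝ}
    {x : Fin m → S} {c b τ : ℝ} (hc : 0 < c) (hb : 0 < b) (hm : 0 < m)
    (hx : ∀ i, c ≤ p (x i) ∧ p (x i) ≤ 1 - c)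
    (hcount : ∀ k, b * m ≤ (Finset.univ.filter fun i => κ (x i) = k).card)
    (ht : ∀ k, |t k| ≤ τ) (hτ : τ / (c * √(b * m)) ≤ 1) :
    ‖∏ i, centeredBernoulliCharFun (p (x i)) (residualWeight p κ t x i) -
      Complex.exp ((-(∑ k, t k ^ 2) / 2 : ℝ))‖ ≤ m * (2 * (τ / (c * √(b * m))) ^ 3) := by
  have hm' : (0 : ℝ) < m := by exact_mod_cast hm
  have hx01 : ∀ i, 0 ≤ p (x i) ∧ p (x i) ≤ 1 := fun i =>
    ⟨by linarith [(hx i).1], by linarith [(hx i).2]⟩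
  have hs : ∀ k, (c * √(b * m)) ^ 2 ≤ ∑ j with κ (x j) = k, p (x j) * (1 - p (x j)) := by
    intro k
    rw [mul_pow, Real.sq_sqrt (by positivity)]
    calc c ^ 2 * (b * m) ≤ c ^ 2 * (Finset.univ.filter fun i => κ (x i) = k).card := by
          gcongr; exact hcount k
      _ ≤ _ := by
          rw [mul_comm, ← nsmul_eq_mul]
          exact Finset.card_nsmul_le_sum _ _ _
            fun i _ => sq_le_mul_one_sub hc.le (hx i).1 (hx i).2
  have hd : 0 < c * √(b * m) := by positivity
  have hs0 : ∀ k, 0 < ∑ j with κ (x j) = k, p (x j) * (1 - p (x j)) := fun k =>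
    lt_of_lt_of_le (by positivity) (hs k)
  have hw : ∀ i, |residualWeight p κ t x i| ≤ τ / (c * √(b * m)) := by
    intro i
    rw [residualWeight, abs_div, abs_of_nonneg (Real.sqrt_nonneg _)]
    have : c * √(b * m) ≤ √(∑ j with κ (x j) = κ (x i), p (x j) * (1 - p (x j))) :=
      Real.le_sqrt_of_sq_le (hs _)
    have := ht (κ (x i))
    have := abs_nonneg (t (κ (x i)))
    gcongr
    linarith
  -- the weights are normalized so that the conditional variance is exactly `∑ k, t k ^ 2`
  have hsq : ∑ i, residualWeight p κ t x i ^ 2 * (p (x i) * (1 - p (x i))) = ∑ k, t k ^ 2 := by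
    rw [← Finset.sum_fiberwise Finset.univ (fun i => κ (x i))]
    refine Finset.sum_congr rfl fun k _ => ?_
    have : ∀ i ∈ Finset.univ.filter (fun i => κ (x i) = k),
        residualWeight p κ t x i ^ 2 * (p (x i) * (1 - p (x i))) =
        t k ^ 2 / (∑ j with κ (x j) = k, p (x j) * (1 - p (x j))) * (p (x i) * (1 - p (x i))) := by
      intro i hi
      have hk : κ (x i) = k := by simpa using hi
      rw [residualWeight, hk, div_pow, Real.sq_sqrt (hs0 k).le]
    rw [Finset.sum_congr rfl this, ← Finset.mul_sum, div_mul_cancel₀ _ (hs0 k).ne']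
  have hexp : Complex.exp ((-(∑ k, t k ^ 2) / 2 : ℝ)) =
      ∏ i, Complex.exp ((-(residualWeight p κ t x i ^ 2 * (p (x i) * (1 - p (x i))) / 2) : ℝ)) := by
    rw [← Complex.exp_sum, ← Complex.ofReal_sum, Finset.sum_neg_distrib, ← Finset.sum_div, hsq,
      neg_div]
  rw [hexp]
  refine (norm_prod_sub_prod_le_sum _ _ _
    (fun i _ => norm_centeredBernoulliCharFun_le_one (hx01 i).1 (hx01 i).2 _) fun i _ => ?_).trans ?_
  · rw [← Complex.ofReal_exp, Complex.norm_real, Real.norm_eq_abs, Real.abs_exp,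
      Real.exp_le_one_iff]
    have := mul_nonneg (hx01 i).1 (sub_nonneg.2 (hx01 i).2)
    have := mul_nonneg (sq_nonneg (residualWeight p κ t x i)) this
    linarith
  · refine (Finset.sum_le_card_nsmul _ _ (2 * (τ / (c * √(b * m))) ^ 3) fun i _ => ?_).trans_eq
      (by simp)
    refine (norm_centeredBernoulliCharFun_sub_exp_le (hx01 i).1 (hx01 i).2
      ((hw i).trans hτ)).trans ?_
    gcongr
    exact hw i

end ConditionalCharFun

/-- An integral of a function that is within `ε` of `w` off an event `B`, and within `2` of `w`
everywhere, is within `ε + 2 Pr(B)` of `w`. -/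
theorem norm_integral_sub_le_add_measureReal {α : Type*} [MeasurableSpace α] {Q : Measure α}
    [IsProbabilityMeasure Q] {Φ : α → ℂ} (hΦ : Integrable Φ Q) {w : ℂ} {ε : ℝ} (hε : 0 ≤ ε)
    {B : Set α} (hB : MeasurableSet B) (h2 : ∀ᵐ a ∂Q, ‖Φ a - w‖ ≤ 2)
    (h : ∀ᵐ a ∂Q, a ∉ B → ‖Φ a - w‖ ≤ ε) : ‖∫ a, Φ a ∂Q - w‖ ≤ ε + 2 * Q.real B := by
  have e : ∫ a, Φ a ∂Q - w = ∫ a, (Φ a - w) ∂Q := by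
    rw [integral_sub hΦ (integrable_const _)]; simp
  have hi : Integrable (fun a => ε + B.indicator (fun _ => (2 : ℝ)) a) Q :=
    (integrable_const _).add ((integrable_const _).indicator hB)
  rw [e]
  refine (norm_integral_le_of_norm_le hi ?_).trans_eq ?_
  · filter_upwards [h2, h] with a h2 h
    by_cases ha : a ∈ B
    · rw [Set.indicator_of_mem ha]; linarith
    · rw [Set.indicator_of_notMem ha]; linarith [h ha]
  · rw [integral_add (integrable_const _) ((integrable_const _).indicator hB),
      integral_indicator_const _ hB]
    simp [mul_comm]

section CharFun

variable {S α : Type*} [MeasurableSpace S] [MeasurableSpace α] {K m : ℕ}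

/-- Averaging the conditional bound: the characteristic function of the vector of standardized
residuals is close to the Gaussian one unless some group is likely to be small. -/
theorem norm_integral_exp_standardizedResidual_sub_le {P : Measure (Obs S)} [IsProbabilityMeasure P]
    {p : S → ℝ} (hp : IsRegressionFunction P p) {c : ℝ} (hc : 0 < c)
    (hpc : ∀ᵐ z ∂P, c ≤ p z.1 ∧ p z.1 ≤ 1 - c)
    (Q : Measure α) [IsProbabilityMeasure Q] {G : α → Fin K → Set S}
    (hG : ∀ k, MeasurableSet {q : α × S | q.2 ∈ G q.1 k})
    (hdisj : ∀ a k l, k ≠ l → Disjoint (G a k) (G a l)) (hcov : ∀ a, ⋃ k, G a k = Set.univ)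
    {b τ : ℝ} (hb : 0 < b) (hm : 0 < m) {t : Fin K → ℝ} (ht : ∀ k, |t k| ≤ τ) (hτ0 : 0 ≤ τ)
    (hτ : τ / (c * √(b * m)) ≤ 1) :
    ‖∫ q, Complex.exp ((∑ k, standardizedResidual p (G q.1) q.2 k * t k : ℝ) * Complex.I)
        ∂(Q.prod (Measure.pi fun _ : Fin m => P)) - Complex.exp ((-(∑ k, t k ^ 2) / 2 : ℝ))‖ ≤
      m * (2 * (τ / (c * √(b * m))) ^ 3) +
        2 * (Q.prod (Measure.pi fun _ : Fin m => P)).real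
          {q | ∃ k, (groupCount (G q.1 k) q.2 : ℝ) < b * m} := by
  classical
  have hp01 : ∀ᵐ z ∂P, 0 ≤ p z.1 ∧ p z.1 ≤ 1 := hpc.mono fun z hz =>
    ⟨by linarith [hz.1], by linarith [hz.2]⟩
  have : IsProbabilityMeasure (P.map Prod.fst) :=
    Measure.isProbabilityMeasure_map measurable_fst.aemeasurable
  have hR := hp.measurePreserving_bernoulliSample hp01 Q m
  set F : α × (Fin m → Obs S) → ℂ := fun q =>
    Complex.exp ((∑ k, standardizedResidual p (G q.1) q.2 k * t k : ℝ) * Complex.I) with hF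
  have hFm : Measurable F := by
    refine Complex.measurable_exp.comp (Measurable.mul_const (Complex.measurable_ofReal.comp ?_) _)
    exact Finset.measurable_fun_sum _ fun k _ => (measurable_standardizedResidual (f := fun _ => p)
      (hp.measurable.comp measurable_snd) (hG k)).mul_const _
  have hFn : ∀ q, ‖F q‖ = 1 := fun q => Complex.norm_exp_ofReal_mul_I _
  have hBm : MeasurableSet {q : α × (Fin m → Obs S) |
      ∃ k, (groupCount (G q.1 k) q.2 : ℝ) < b * m} := measurableSet_exists_groupCount_lt hG _
  -- group counts depend on the covariates only, so the responses may be filled in arbitrarily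
  set B : Set (α × (Fin m → S)) :=
    {r | ∃ k, (groupCount (G r.1 k) (fun i => (r.2 i, false)) : ℝ) < b * m} with hBdef
  have hB : MeasurableSet B := by
    have h : Measurable fun r : α × (Fin m → S) =>
      (r.1, (fun i => (r.2 i, false) : Fin m → Obs S)) := by fun_prop
    exact h hBm
  have hBreal : (Q.prod (Measure.pi fun _ : Fin m => P)).real
      {q | ∃ k, (groupCount (G q.1 k) q.2 : ℝ) < b * m} =
      (Q.prod (Measure.pi fun _ : Fin m => P.map Prod.fst)).real B := by
    rw [← hR.measureReal_preimage hBm.nullMeasurableSet]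
    have : (fun q : (α × (Fin m → S)) × (Fin m → ℝ) =>
        (q.1.1, fun i => bernoulliObs p (q.1.2 i, q.2 i))) ⁻¹'
        {q | ∃ k, (groupCount (G q.1 k) q.2 : ℝ) < b * m} = B ×ˢ Set.univ := by
      ext q
      simp only [Set.mem_preimage, Set.mem_prod, Set.mem_univ, and_true, hBdef]
      rfl
    rw [this, measureReal_prod_prod]
    simp
  have hFint : Integrable F (Q.prod (Measure.pi fun _ : Fin m => P)) :=
    Integrable.of_bound hFm.aestronglyMeasurable 1 (ae_of_all _ fun q => (hFn q).le)
  have hFR := hR.integrable_comp_of_integrable hFint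
  have hI : ∫ q, F q ∂(Q.prod (Measure.pi fun _ : Fin m => P)) =
      ∫ r, ∫ u, F (r.1, fun i => bernoulliObs p (r.2 i, u i)) ∂(Measure.pi fun _ => unif)
        ∂(Q.prod (Measure.pi fun _ : Fin m => P.map Prod.fst)) := by
    rw [← hR.map_eq, integral_map hR.measurable.aemeasurable hFm.aestronglyMeasurable]
    exact integral_prod _ hFR
  have hxc : ∀ᵐ r ∂(Q.prod (Measure.pi fun _ : Fin m => P.map Prod.fst)),
      ∀ i, c ≤ p (r.2 i) ∧ p (r.2 i) ≤ 1 - c := by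
    rw [ae_all_iff]
    intro i
    have h1 : ∀ᵐ x ∂(P.map Prod.fst), c ≤ p x ∧ p x ≤ 1 - c := by
      rw [ae_map_iff measurable_fst.aemeasurable]
      · exact hpc
      · exact (measurableSet_le measurable_const hp.measurable).inter
          (measurableSet_le hp.measurable measurable_const)
    exact ((measurePreserving_eval (fun _ : Fin m => P.map Prod.fst) i).comp
      measurePreserving_snd).quasiMeasurePreserving.ae h1
  have hΦ : Integrable
      (fun r => ∫ u, F (r.1, fun i => bernoulliObs p (r.2 i, u i)) ∂(Measure.pi fun _ => unif))
      (Q.prod (Measure.pi fun _ : Fin m => P.map Prod.fst)) := hFR.integral_prod_left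
  rw [hI, hBreal]
  refine norm_integral_sub_le_add_measureReal hΦ (by positivity) hB (ae_of_all _ fun r => ?_) ?_
  · refine (norm_sub_le _ _).trans ?_
    have h1 : ‖∫ u, F (r.1, fun i => bernoulliObs p (r.2 i, u i)) ∂(Measure.pi fun _ => unif)‖ ≤
        1 := by
      refine (norm_integral_le_of_norm_le_const (ae_of_all _ fun u => (hFn _).le)).trans ?_
      simp
    have h2 : ‖Complex.exp ((-(∑ k, t k ^ 2) / 2 : ℝ))‖ ≤ 1 := by
      rw [← Complex.ofReal_exp, Complex.norm_real, Real.norm_eq_abs, Real.abs_exp,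
        Real.exp_le_one_iff]
      have : 0 ≤ ∑ k, t k ^ 2 := Finset.sum_nonneg fun k _ => sq_nonneg _
      linarith
    linarith
  · filter_upwards [hxc] with r hr hrB
    obtain ⟨κ, hκ⟩ := exists_groupIndex (hdisj r.1) (hcov r.1)
    simp only [hF]
    rw [integral_exp_standardizedResidual hκ t fun i =>
      ⟨by linarith [(hr i).1], by linarith [(hr i).2]⟩]
    refine norm_prod_centeredBernoulliCharFun_sub_le hc hb hm hr (fun k => ?_) ht hτ
    have : b * m ≤ (groupCount (G r.1 k) (fun i => (r.2 i, false)) : ℝ) := by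
      by_contra hlt
      exact hrB ⟨k, not_le.1 hlt⟩
    refine this.trans_eq ?_
    rw [groupCount]
    simp only [hκ]

end CharFun

/-! ### Stochastic bounds along the split sample -/

/-- The stochastic bounds on the group sizes hold simultaneously for the finitely many groups. -/
theorem SufficientGroupSize.forall_group {Ω S : Type*} [MeasurableSpace Ω] [MeasurableSpace S]
    {μ : Measure Ω} {P : Measure (Obs S)} {n₁ n₂ : ℕ → ℕ} {K : ℕ} {D : SplitSample μ P n₁ n₂}
    {G : Grouping S K n₁}
    (h : SufficientGroupSize D G) {ε : ℝ≥0∞} (hε : 0 < ε) : ∃ c : ℝ, 0 < c ∧ ∀ᶠ n in atTop,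
      μ {ω | ∃ k, (groupCount (G.group n (D.train n ω) k) (D.test n ω) : ℝ) < c * n₂ n} ≤ ε := by
  have hεK : 0 < ε / (K : ℝ≥0∞) := ENNReal.div_pos hε.ne' (ENNReal.natCast_ne_top K)
  choose c hc hev using fun k => h k (ε / K) hεK
  have hmin : ∃ b : ℝ, 0 < b ∧ ∀ k, b ≤ c k := by
    have h1 : ∀ᶠ b in 𝓝[>] (0 : ℝ), ∀ k, b ≤ c k :=
      eventually_all.2 fun k => mem_nhdsWithin_of_mem_nhds (Iic_mem_nhds (hc k))
    obtain ⟨b, hb, hb0⟩ := (h1.and self_mem_nhdsWithin).exists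
    exact ⟨b, hb0, hb⟩
  obtain ⟨b, hb, hbc⟩ := hmin
  refine ⟨b, hb, (eventually_all.2 hev).mono fun n hn => ?_⟩
  calc μ {ω | ∃ k, (groupCount (G.group n (D.train n ω) k) (D.test n ω) : ℝ) < b * n₂ n}
      ≤ μ (⋃ k, {ω | (groupCount (G.group n (D.train n ω) k) (D.test n ω) : ℝ) < c k * n₂ n}) := by
        refine measure_mono fun ω hω => ?_
        obtain ⟨k, hk⟩ := hω
        exact Set.mem_iUnion.2 ⟨k, hk.trans_le (by have := hbc k; gcongr)⟩
    _ ≤ ∑ k : Fin K, ε / K := (measure_iUnion_fintype_le _ _).trans (Finset.sum_le_sum fun k _ => hn k)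
    _ ≤ ε := by
        simp only [Finset.sum_const, Finset.card_univ, Fintype.card_fin, nsmul_eq_mul]
        exact ENNReal.mul_div_le

theorem tendsto_atTop_of_ratio_tendsto_zero {n₁ n₂ : ℕ → ℕ} (hn₁ : ∀ᶠ n in atTop, 0 < n₁ n)
    (hn₂ : Tendsto n₂ atTop atTop) (hratio : Tendsto (fun n => (n₂ n : ℝ) / n₁ n) atTop (𝓝 0)) :
    Tendsto n₁ atTop atTop := by
  refine tendsto_atTop_mono' _ ?_ hn₂
  filter_upwards [hn₁, hratio.eventually_le_const one_pos] with n h1 h2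
  rw [div_le_one (by exact_mod_cast h1)] at h2
  exact_mod_cast h2

section SplitSampleEvents

variable {Ω S : Type*} [MeasurableSpace Ω] [MeasurableSpace S] {μ : Measure Ω}
  [IsProbabilityMeasure μ] {P : Measure (Obs S)} [IsProbabilityMeasure P] {n₁ n₂ : ℕ → ℕ}

theorem SplitSample.measurePreserving_train (D : SplitSample μ P n₁ n₂) (n : ℕ) :
    MeasurePreserving (D.train n) μ (Measure.pi fun _ => P) :=
  measurePreserving_fst.comp (D.measurePreserving_train_test n)

theorem SplitSample.measurePreserving_test (D : SplitSample μ P n₁ n₂) (n : ℕ) :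
    MeasurePreserving (D.test n) μ (Measure.pi fun _ => P) :=
  measurePreserving_snd.comp (D.measurePreserving_train_test n)

theorem SplitSample.ae_forall_test (D : SplitSample μ P n₁ n₂) {A : Obs S → Prop}
    (hA : ∀ᵐ z ∂P, A z) (n : ℕ) : ∀ᵐ ω ∂μ, ∀ i, A (D.test n ω i) :=
  ae_all_iff.2 fun i =>
    ((measurePreserving_eval _ i).comp (D.measurePreserving_test n)).quasiMeasurePreserving.ae hA

/-- The rate assumption on the fit, stated for samples from the population, transfers to the training
data. The supremum need not be measurable, but passing to an image measure can only increase the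
outer measure. -/
theorem SupErrorBigOInProb.train {E : Estimator S} {f : S → ℝ} {r : ℕ → ℝ}
    (h : SupErrorBigOInProb P E f r) (D : SplitSample μ P n₁ n₂) (hn₁ : Tendsto n₁ atTop atTop)
    {ε : ℝ≥0∞} (hε : 0 < ε) : ∃ C : ℝ, 0 < C ∧ ∀ᶠ n in atTop,
      μ {ω | ENNReal.ofReal (C * r (n₁ n)) <
        ⨆ x, ENNReal.ofReal |E.fit (n₁ n) (D.train n ω) x - f x|} ≤ ε := by
  obtain ⟨C, hC, hev⟩ := h ε hε
  refine ⟨C, hC, (hn₁.eventually hev).mono fun n hn => le_trans ?_ hn⟩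
  have hD := D.measurePreserving_train n
  conv_rhs => rw [← hD.map_eq]
  exact Measure.le_map_apply hD.measurable.aemeasurable _

end SplitSampleEvents

/-! ### Limit distribution under the null hypothesis -/

section Null

variable {Ω S : Type*} [MeasurableSpace Ω] [MeasurableSpace S] {μ : Measure Ω}
  [IsProbabilityMeasure μ] {P : Measure (Obs S)} [IsProbabilityMeasure P] {p : S → ℝ}
  {n₁ n₂ : ℕ → ℕ} {K : ℕ}

/-- The vector of the standardized residuals of the groups, computed with `f`. -/
noncomputable def residualVector (D : SplitSample μ P n₁ n₂) (G : Grouping S K n₁)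
    (f : ∀ n, (Fin (n₁ n) → Obs S) → S → ℝ) (n : ℕ) (ω : Ω) : EuclideanSpace ℝ (Fin K) :=
  WithLp.toLp 2 (standardizedResidual (f n (D.train n ω)) (G.group n (D.train n ω)) (D.test n ω))

theorem measurable_residualVector (D : SplitSample μ P n₁ n₂) (G : Grouping S K n₁)
    {f : ∀ n, (Fin (n₁ n) → Obs S) → S → ℝ}
    (hf : ∀ n, Measurable fun q : (Fin (n₁ n) → Obs S) × S => f n q.1 q.2) (n : ℕ) :
    Measurable (residualVector D G f n) := by
  have h : ∀ k, Measurable fun ω =>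
      standardizedResidual (f n (D.train n ω)) (G.group n (D.train n ω)) (D.test n ω) k := by
    intro k
    have h1 := measurable_standardizedResidual (m := n₂ n) (f := f n) (G := G.group n) (k := k)
      (hf n) (G.measurable_group n k)
    simpa only [Function.comp_def] using h1.comp (D.measurePreserving_train_test n).measurable
  exact (WithLp.measurable_toLp 2 (Fin K → ℝ)).comp (measurable_pi_lambda _ h)

/-- The error bounds of `norm_integral_exp_standardizedResidual_sub_le` vanish as the size of the test
data grows. -/
theorem tendsto_charFun_error (τ : ℝ) {c b : ℝ} (hb : 0 < b) :
    Tendsto (fun m : ℕ => m * (2 * (τ / (c * √(b * m))) ^ 3)) atTop (𝓝 0) ∧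
      Tendsto (fun m : ℕ => τ / (c * √(b * m))) atTop (𝓝 0) := by
  have hs : Tendsto (fun m : ℕ => (√(b * m))⁻¹) atTop (𝓝 0) :=
    tendsto_inv_atTop_zero.comp (Real.tendsto_sqrt_atTop.comp
      (tendsto_natCast_atTop_atTop.const_mul_atTop hb))
  constructor
  · have h := hs.const_mul (2 * τ ^ 3 / (c ^ 3 * b))
    rw [mul_zero] at h
    refine h.congr' ((eventually_gt_atTop 0).mono fun m hm => ?_)
    have hm' : (0 : ℝ) < m := by exact_mod_cast hm
    have h0 : 0 < √(b * m) := by positivity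
    have h2 : √(b * m) ^ 2 = b * m := Real.sq_sqrt (by positivity)
    simp only [div_pow, mul_pow, pow_succ √(b * m) 2, h2]
    field_simp
  · have h := hs.const_mul (τ / c)
    rw [mul_zero] at h
    refine h.congr fun m => ?_
    rw [← div_eq_mul_inv, div_div]

/-- Central limit theorem for the residuals of the adaptive groups, standardized with the true
regression function. -/
theorem tendstoInDistribution_residualVector (hp : IsRegressionFunction P p)
    (D : SplitSample μ P n₁ n₂) (G : Grouping S K n₁) (h1 : SufficientGroupSize D G)
    (h2 : BoundedProbability P p) (hn₂ : Tendsto n₂ atTop atTop) :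
    TendstoInDistribution (residualVector D G fun _ _ => p) atTop id (fun _ => μ)
      (stdGaussian (EuclideanSpace ℝ (Fin K))) := by
  have hZm := measurable_residualVector D G (f := fun _ _ => p)
    fun n => hp.measurable.comp measurable_snd
  refine ⟨fun n => (hZm n).aemeasurable, aemeasurable_id, ?_⟩
  refine ProbabilityMeasure.tendsto_iff_tendsto_charFun.2 fun t => ?_
  obtain ⟨c, hc, -, hpc⟩ := h2
  simp only [ProbabilityMeasure.coe_mk, Measure.map_id, charFun_stdGaussian]
  refine Metric.tendsto_nhds.2 fun ε hε => ?_
  have hε' : (0 : ℝ≥0∞) < ENNReal.ofReal (ε / 8) := ENNReal.ofReal_pos.2 (by positivity)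
  -- `ε / 8` leaves room for the factor `2` in the bound on the characteristic function
  obtain ⟨b, hb, hcount⟩ := h1.forall_group hε'
  obtain ⟨e1, e2⟩ := tendsto_charFun_error ‖t‖ (c := c) hb
  filter_upwards [hcount, hn₂.eventually_gt_atTop 0,
    (e1.comp hn₂).eventually_lt_const (half_pos hε), (e2.comp hn₂).eventually_le_const one_pos]
    with n hcn hn0 he1 he2
  have hTT := D.measurePreserving_train_test n
  have key := norm_integral_exp_standardizedResidual_sub_le hp hc hpc
    (Measure.pi fun _ : Fin (n₁ n) => P) (G.measurable_group n) (G.disjoint_group n)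
    (G.cover_group n) hb hn0 (t := t) (fun k => PiLp.norm_apply_le t k) (norm_nonneg t) he2
  have hFm : Measurable fun q : (Fin (n₁ n) → Obs S) × (Fin (n₂ n) → Obs S) =>
      Complex.exp ((∑ k, standardizedResidual p (G.group n q.1) q.2 k * t k : ℝ) * Complex.I) := by
    refine Complex.measurable_exp.comp (Measurable.mul_const (Complex.measurable_ofReal.comp ?_) _)
    exact Finset.measurable_fun_sum _ fun k _ => (measurable_standardizedResidual (f := fun _ => p)
      (hp.measurable.comp measurable_snd) (G.measurable_group n k)).mul_const _
  have hcf : charFun (μ.map (residualVector D G (fun _ _ => p) n)) t =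
      ∫ q, Complex.exp ((∑ k, standardizedResidual p (G.group n q.1) q.2 k * t k : ℝ) * Complex.I)
        ∂((Measure.pi fun _ : Fin (n₁ n) => P).prod (Measure.pi fun _ : Fin (n₂ n) => P)) := by
    rw [charFun_apply, integral_map (hZm n).aemeasurable (by fun_prop), ← hTT.map_eq,
      integral_map hTT.measurable.aemeasurable hFm.aestronglyMeasurable]
    refine integral_congr_ae (ae_of_all _ fun ω => ?_)
    simp only [residualVector, PiLp.inner_apply, RCLike.inner_apply, conj_trivial]
    simp only [mul_comm]
  have hnorm : (-(∑ k, t k ^ 2) / 2 : ℝ) = -‖t‖ ^ 2 / 2 := by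
    rw [EuclideanSpace.real_norm_sq_eq]
  have hbad : ((Measure.pi fun _ : Fin (n₁ n) => P).prod
      (Measure.pi fun _ : Fin (n₂ n) => P)).real
      {q | ∃ k, (groupCount (G.group n q.1 k) q.2 : ℝ) < b * n₂ n} ≤ ε / 8 := by
    have hBm : MeasurableSet {q : (Fin (n₁ n) → Obs S) × (Fin (n₂ n) → Obs S) |
        ∃ k, (groupCount (G.group n q.1 k) q.2 : ℝ) < b * n₂ n} :=
      measurableSet_exists_groupCount_lt (G.measurable_group n) _
    rw [← hTT.measureReal_preimage hBm.nullMeasurableSet]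
    exact ENNReal.toReal_le_of_le_ofReal (by positivity) hcn
  rw [hcf, dist_eq_norm]
  rw [hnorm] at key
  push_cast at key
  simp only [Function.comp_apply] at he1
  push_cast
  refine key.trans_lt ?_
  linarith

/-- Replacing the true regression function by an estimator with the parametric rate changes the
standardized residuals by `O_p(√(n₂ / n₁))`, which is negligible. -/
theorem tendstoInMeasure_residualVector_sub (D : SplitSample μ P n₁ n₂) (E : Estimator S)
    (G : Grouping S K n₁)
    (h2 : BoundedProbability P p) (hE : SupErrorBigOInProb P E p parametricRate)
    (hn₁ : Tendsto n₁ atTop atTop)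
    (hratio : Tendsto (fun n => (n₂ n : ℝ) / n₁ n) atTop (𝓝 0)) :
    TendstoInMeasure μ (residualVector D G (fun n => E.fit (n₁ n)) -
      residualVector D G fun _ _ => p) atTop 0 := by
  obtain ⟨c, hc, -, hpc⟩ := h2
  rw [tendstoInMeasure_iff_norm]
  intro η hη
  rw [ENNReal.tendsto_nhds_zero]
  intro ε hε
  obtain ⟨C, hC, hev⟩ := hE.train D hn₁ hε
  have hrate : Tendsto (fun n => C * parametricRate (n₁ n)) atTop (𝓝 0) := by
    have := (tendsto_rpow_neg_atTop (by norm_num : (0 : ℝ) < 1 / 2)).comp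
      (tendsto_natCast_atTop_atTop.comp hn₁)
    simpa [parametricRate] using this.const_mul C
  have hsqrt : Tendsto (fun n => (K : ℝ) * ((2 / c + 2 / c ^ 3) *
      (C * √((n₂ n : ℝ) / n₁ n))) ^ 2) atTop (𝓝 0) := by
    have h := (Real.continuous_sqrt.tendsto 0).comp hratio
    rw [Real.sqrt_zero] at h
    simpa using (((h.const_mul C).const_mul (2 / c + 2 / c ^ 3)).pow 2).const_mul (K : ℝ)
  filter_upwards [hev, hrate.eventually_le_const (half_pos hc),
    hsqrt.eventually_lt_const (by positivity : 0 < η ^ 2)] with n hn hδ hsmall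
  refine le_trans (measure_mono_ae ?_) hn
  filter_upwards [D.ae_forall_test hpc n] with ω hω hmem
  refine lt_of_not_ge fun hsup => ?_
  -- off the event of a large uniform error the fit is uniformly close to `p`
  have hδ0 : 0 ≤ C * parametricRate (n₁ n) := by unfold parametricRate; positivity
  have hq : ∀ x, |E.fit (n₁ n) (D.train n ω) x - p x| ≤ C * parametricRate (n₁ n) := fun x =>
    (ENNReal.ofReal_le_ofReal_iff hδ0).1 ((le_iSup (fun x =>
      ENNReal.ofReal |E.fit (n₁ n) (D.train n ω) x - p x|) x).trans hsup)
  refine absurd hmem (not_le.2 ?_)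
  have hcoord : ∀ k, ((residualVector D G (fun n => E.fit (n₁ n)) -
      residualVector D G fun _ _ => p) n ω) k ^ 2 ≤
      ((2 / c + 2 / c ^ 3) * (C * √((n₂ n : ℝ) / n₁ n))) ^ 2 := by
    intro k
    rw [← sq_abs]
    refine pow_le_pow_left₀ (abs_nonneg _) ?_ 2
    classical
    refine (abs_standardizedSum_sub_le
      (Finset.univ.filter fun i => (D.test n ω i).1 ∈ G.group n (D.train n ω) k)
      (fun i => resp (D.test n ω i).2) (fun i => p (D.test n ω i).1)
      (fun i => E.fit (n₁ n) (D.train n ω) (D.test n ω i).1) hc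
      (fun i _ => resp_mem_Icc _) (fun i _ => hω i) hδ hδ0 (fun i _ => hq _)).trans' ?_ |>.trans ?_
    · simp only [residualVector, standardizedResidual, Pi.sub_apply, PiLp.sub_apply]
      refine le_of_eq ?_
      congr!
    · have hcard : ((Finset.univ.filter fun i => (D.test n ω i).1 ∈
          G.group n (D.train n ω) k).card : ℝ) ≤ n₂ n := by
        exact_mod_cast (Finset.card_le_univ _).trans_eq (Fintype.card_fin _)
      have hr : parametricRate (n₁ n) = (√(n₁ n))⁻¹ := by
        rw [parametricRate, Real.rpow_neg (Nat.cast_nonneg _), Real.sqrt_eq_rpow]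
      rw [Real.sqrt_div (Nat.cast_nonneg _), div_eq_mul_inv (√(n₂ n : ℝ)), ← hr]
      calc _ ≤ (2 / c + 2 / c ^ 3) * (√(n₂ n) * (C * parametricRate (n₁ n))) := by
            have := Real.sqrt_le_sqrt hcard
            gcongr
        _ = _ := by ring
  have hsq : ‖(residualVector D G (fun n => E.fit (n₁ n)) -
      residualVector D G fun _ _ => p) n ω‖ ^ 2 < η ^ 2 := by
    rw [EuclideanSpace.real_norm_sq_eq]
    refine lt_of_le_of_lt (Finset.sum_le_card_nsmul _ _ _ fun k _ => hcoord k) ?_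
    simpa using hsmall
  simpa using lt_of_pow_lt_pow_left₀ 2 hη.le hsq

theorem map_sum_sq_stdGaussian :
    (stdGaussian (EuclideanSpace ℝ (Fin K))).map (fun v => ∑ k, v k ^ 2) = chiSquared K := by
  rw [← map_pi_eq_stdGaussian, Measure.map_map (by fun_prop) (by fun_prop)]
  rfl

theorem tendstoInDistribution_BAG (hp : IsRegressionFunction P p)
    (D : SplitSample μ P n₁ n₂) (E : Estimator S) (G : Grouping S K n₁)
    (h1 : SufficientGroupSize D G) (h2 : BoundedProbability P p)
    (hE : SupErrorBigOInProb P E p parametricRate)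
    (hn₁ : Tendsto n₁ atTop atTop) (hn₂ : Tendsto n₂ atTop atTop)
    (hratio : Tendsto (fun n => (n₂ n : ℝ) / n₁ n) atTop (𝓝 0)) :
    TendstoInDistribution (BAG D E G) atTop id (fun _ => μ) (chiSquared K) := by
  have hW := tendstoInDistribution_of_tendstoInMeasure_sub
    (residualVector D G (fun n => E.fit (n₁ n))) id
    (tendstoInDistribution_residualVector hp D G h1 h2 hn₂)
    (tendstoInMeasure_residualVector_sub D E G h2 hE hn₁ hratio)
    fun n => (measurable_residualVector D G (fun n => E.measurable_fit (n₁ n)) n).aemeasurable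
  have hg : Continuous fun v : EuclideanSpace ℝ (Fin K) => ∑ k, v k ^ 2 := by fun_prop
  have h := hW.continuous_comp hg
  refine ⟨h.forall_aemeasurable, aemeasurable_id, ?_⟩
  have ht := h.tendsto
  simp only [Function.comp_id, map_sum_sq_stdGaussian] at ht
  simp only [Measure.map_id]
  exact ht

end Null

/-! ### Divergence under the alternative -/

section Concentration

variable {Z α : Type*} [MeasurableSpace Z] [MeasurableSpace α] {P : Measure Z}
  [IsProbabilityMeasure P] {m : ℕ}

/-- Chebyshev's inequality for the sum of a function bounded by `1` over a sample. -/
theorem measure_pi_le_abs_sum_sub_le {f : Z → ℝ} (hf : Measurable f) (hb : ∀ z, |f z| ≤ 1)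
    {ε : ℝ} (hε : 0 < ε) (hm : 0 < m) :
    (Measure.pi fun _ : Fin m => P) {T | ε * m ≤ |∑ i, f (T i) - m * ∫ z, f z ∂P|} ≤
      ENNReal.ofReal (1 / (ε ^ 2 * m)) := by
  have hm' : (0 : ℝ) < m := by exact_mod_cast hm
  have hL : MemLp f 2 P := MemLp.of_bound hf.aestronglyMeasurable 1 (ae_of_all _ hb)
  have hLi : ∀ i : Fin m, MemLp (fun T : Fin m → Z => f (T i)) 2 (Measure.pi fun _ : Fin m => P) :=
    fun i => hL.comp_measurePreserving (measurePreserving_eval (fun _ : Fin m => P) i)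
  have hmean : ∫ T, ∑ i, f (T i) ∂(Measure.pi fun _ : Fin m => P) = m * ∫ z, f z ∂P := by
    rw [integral_finsetSum _ fun i _ => (hLi i).integrable (by norm_num)]
    simp [integral_comp_eval (μ := fun _ : Fin m => P) hf.aestronglyMeasurable]
  have hvar : Var[fun T : Fin m → Z => ∑ i, f (T i); Measure.pi fun _ : Fin m => P] ≤ m := by
    have h := variance_sum_pi (μ := fun _ : Fin m => P) (X := fun _ => f) fun _ => hL
    have e : (∑ i : Fin m, fun T : Fin m → Z => f (T i)) = fun T => ∑ i, f (T i) := by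
      funext T; simp
    rw [← e, h]
    refine (Finset.sum_le_card_nsmul _ _ 1 fun i _ => ?_).trans_eq (by simp)
    refine (variance_le_sq_of_bounded (a := -1) (b := 1)
      (ae_of_all _ fun z => abs_le.1 (hb z)) hf.aemeasurable).trans_eq (by norm_num)
  have h := meas_ge_le_variance_div_sq (memLp_finsetSum Finset.univ fun i _ => hLi i)
    (by positivity : 0 < ε * m)
  rw [hmean] at h
  refine h.trans (ENNReal.ofReal_le_ofReal ?_)
  calc _ ≤ (m : ℝ) / (ε * m) ^ 2 := by gcongr
    _ = 1 / (ε ^ 2 * m) := by field_simp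

/-- Conditional Chebyshev inequality: the summands may depend on independent training data. -/
theorem measure_prod_le_abs_sum_sub_le (Q : Measure α) [IsProbabilityMeasure Q] {f : α → Z → ℝ}
    (hf : Measurable fun q : α × Z => f q.1 q.2) (hb : ∀ a z, |f a z| ≤ 1)
    {ε : ℝ} (hε : 0 < ε) (hm : 0 < m) :
    (Q.prod (Measure.pi fun _ : Fin m => P))
      {q | ε * m ≤ |∑ i, f q.1 (q.2 i) - m * ∫ z, f q.1 z ∂P|} ≤
      ENNReal.ofReal (1 / (ε ^ 2 * m)) := by
  have hmean : Measurable fun a => ∫ z, f a z ∂P :=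
    hf.stronglyMeasurable.integral_prod_right'.measurable
  have hsum : Measurable fun q : α × (Fin m → Z) => ∑ i, f q.1 (q.2 i) :=
    Finset.measurable_fun_sum _ fun i _ => by
      have h : Measurable fun q : α × (Fin m → Z) => (q.1, q.2 i) := by fun_prop
      exact hf.comp h
  have hS : MeasurableSet {q : α × (Fin m → Z) |
      ε * m ≤ |∑ i, f q.1 (q.2 i) - m * ∫ z, f q.1 z ∂P|} :=
    measurableSet_le measurable_const
      (hsum.sub ((hmean.comp measurable_fst).const_mul _)).abs
  rw [Measure.prod_apply hS]
  calc _ ≤ ∫⁻ _, ENNReal.ofReal (1 / (ε ^ 2 * m)) ∂Q := lintegral_mono fun a =>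
        measure_pi_le_abs_sum_sub_le (hf.comp measurable_prodMk_left) (hb a) hε hm
    _ = _ := by simp

end Concentration

/-- A standardized sum of residuals is large when the sum itself is, since the nominal variance is at
most the number of summands. -/
theorem div_le_sq_standardizedSum {ι : Type*} (I : Finset ι) (y q : ι → ℝ) {c A m : ℝ}
    (hc : 0 < c) (hA : 0 < A) (hq : ∀ i ∈ I, c ≤ q i ∧ q i ≤ 1 - c) (hI : (I.card : ℝ) ≤ m)
    (h : A ≤ |∑ i ∈ I, (y i - q i)|) :
    A ^ 2 / m ≤ ((∑ i ∈ I, (y i - q i)) / √(∑ i ∈ I, q i * (1 - q i))) ^ 2 := by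
  -- a nonzero residual sum rules out an empty group, for which the quotient would be `0 / 0`
  rcases I.eq_empty_or_nonempty with rfl | hne
  · simp at h; linarith
  have hpos : 0 < ∑ i ∈ I, q i * (1 - q i) := Finset.sum_pos (fun i hi =>
    lt_of_lt_of_le (by positivity) (sq_le_mul_one_sub hc.le (hq i hi).1 (hq i hi).2)) hne
  have hle : ∑ i ∈ I, q i * (1 - q i) ≤ m := by
    refine (Finset.sum_le_card_nsmul _ _ 1 fun i _ => ?_).trans ?_
    · nlinarith [sq_nonneg (q i - 1 / 2)]
    · simpa using hI
  rw [div_pow, Real.sq_sqrt hpos.le, ← sq_abs (∑ i ∈ I, (y i - q i))]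
  gcongr

/-- The residual with respect to `q`, restricted to the group `A`. -/
noncomputable def groupResidual {S : Type*} (q : S → ℝ) (A : Set S) (z : Obs S) : ℝ :=
  (Prod.fst ⁻¹' A).indicator (fun z : Obs S => resp z.2 - q z.1) z

theorem abs_groupResidual_le {S : Type*} {q : S → ℝ} (hq : ∀ x, 0 ≤ q x ∧ q x ≤ 1) (A : Set S)
    (z : Obs S) :
    |groupResidual q A z| ≤ 1 := by
  unfold groupResidual
  by_cases hz : z ∈ Prod.fst ⁻¹' A
  · rw [Set.indicator_of_mem hz, abs_le]
    have := resp_mem_Icc z.2; have := hq z.1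
    constructor <;> linarith
  · rw [Set.indicator_of_notMem hz]; simp

/-- A lower bound for the statistic when, for some group, the expected residual `e` with respect to
`pa` exceeds `c₄` in absolute value, the sum of these residuals over the test data is close to
`m e`, and the fit `q` is close to `pa`. -/
theorem le_bagStat {S : Type*} {K m : ℕ} (hm : 0 < m) {q pa : S → ℝ}
    {G : Fin K → Set S} {T : Fin m → Obs S}
    {c₃ c₄ δ e : ℝ} (h₃ : 0 < c₃) (h₄ : 0 < c₄) (hδ₃ : δ ≤ c₃ / 2) (hδ₄ : δ ≤ c₄ / 4)
    (hpa : ∀ i, c₃ ≤ pa (T i).1 ∧ pa (T i).1 ≤ 1 - c₃) (hq : ∀ x, |q x - pa x| ≤ δ) {k : Fin K}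
    (hk : c₄ < |e|)
    (hsum : |∑ i, groupResidual pa (G k) (T i) - m * e| <
      c₄ / 2 * m) :
    c₄ ^ 2 / 16 * m ≤ bagStat q G T := by
  classical
  have hm' : (0 : ℝ) < m := by exact_mod_cast hm
  set I := Finset.univ.filter fun i => (T i).1 ∈ G k with hI
  have hcard : (I.card : ℝ) ≤ m := by
    exact_mod_cast (Finset.card_le_univ _).trans_eq (Fintype.card_fin _)
  have hs : ∑ i, groupResidual pa (G k) (T i) = ∑ i ∈ I, (resp (T i).2 - pa (T i).1) := by
    rw [hI, Finset.sum_filter]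
    exact Finset.sum_congr rfl fun i _ => by simp [groupResidual, Set.indicator]
  have hdiff : |∑ i ∈ I, (q (T i).1 - pa (T i).1)| ≤ c₄ / 4 * m := by
    refine (Finset.abs_sum_le_sum_abs _ _).trans ?_
    refine (Finset.sum_le_card_nsmul _ _ (c₄ / 4) fun i _ => (hq _).trans hδ₄).trans ?_
    rw [nsmul_eq_mul, mul_comm]
    gcongr
  have hdec : ∑ i ∈ I, (resp (T i).2 - q (T i).1) =
      ∑ i ∈ I, (resp (T i).2 - pa (T i).1) - ∑ i ∈ I, (q (T i).1 - pa (T i).1) := by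
    rw [← Finset.sum_sub_distrib]
    exact Finset.sum_congr rfl fun i _ => by ring
  rw [hs] at hsum
  have hbig : c₄ * m < |(m : ℝ) * e| := by
    rw [abs_mul, abs_of_pos hm', mul_comm]
    gcongr
  have hA : c₄ / 4 * m ≤ |∑ i ∈ I, (resp (T i).2 - q (T i).1)| := by
    rw [hdec]
    have t1 := abs_sub_abs_le_abs_sub ((m : ℝ) * e)
      (∑ i ∈ I, (resp (T i).2 - pa (T i).1))
    rw [abs_sub_comm] at t1
    have t2 := abs_sub_abs_le_abs_sub (∑ i ∈ I, (resp (T i).2 - pa (T i).1))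
      (∑ i ∈ I, (q (T i).1 - pa (T i).1))
    linarith
  have h := div_le_sq_standardizedSum I (fun i => resp (T i).2) (fun i => q (T i).1) (half_pos h₃)
    (by positivity) (fun i _ => by
      have := abs_le.1 (hq (T i).1); have := hpa i
      constructor <;> linarith) hcard hA
  have hterm : standardizedResidual q G T k ^ 2 ≤ bagStat q G T := by
    rw [bagStat_eq_sum_sq]
    exact Finset.single_le_sum (f := fun k => standardizedResidual q G T k ^ 2)
      (fun _ _ => sq_nonneg _) (Finset.mem_univ k)
  refine le_trans ?_ (h.trans (le_trans (le_of_eq ?_) hterm))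
  · refine le_of_eq ?_
    field_simp
    ring
  · simp only [standardizedResidual, hI]

section Alternative

variable {Ω S : Type*} [MeasurableSpace Ω] [MeasurableSpace S] {μ : Measure Ω}
  [IsProbabilityMeasure μ] {P : Measure (Obs S)} [IsProbabilityMeasure P] {p pa : S → ℝ}
  {n₁ n₂ : ℕ → ℕ} {K : ℕ}

theorem integral_groupResidual (hp : IsRegressionFunction P p) {q : S → ℝ} (hqm : Measurable q)
    (hq : ∀ x, 0 ≤ q x ∧ q x ≤ 1) {A : Set S} (hA : MeasurableSet A) :
    ∫ z, groupResidual q A z ∂P = ∫ z, A.indicator (fun x => p x - q x) z.1 ∂P := by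
  have hqi : Integrable (fun z : Obs S => q z.1) P :=
    Integrable.of_bound (hqm.comp measurable_fst).aestronglyMeasurable 1 (ae_of_all _ fun z => by
      rw [Real.norm_eq_abs, abs_of_nonneg (hq _).1]; exact (hq _).2)
  have hAm : MeasurableSet (Prod.fst ⁻¹' A : Set (Obs S)) := measurable_fst hA
  have e : ∀ z : Obs S, A.indicator (fun x => p x - q x) z.1 =
      (Prod.fst ⁻¹' A).indicator (fun z : Obs S => p z.1 - q z.1) z := fun z => rfl
  simp only [groupResidual, e]
  rw [integral_indicator hAm, integral_indicator hAm,
    integral_sub integrable_resp.integrableOn hqi.integrableOn,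
    integral_sub hp.integrable.integrableOn hqi.integrableOn, hp.setIntegral_eq hA]

theorem measurable_groupResidual {α : Type*} [MeasurableSpace α] {q : S → ℝ} (hq : Measurable q)
    {G : α → Set S} (hG : MeasurableSet {r : α × S | r.2 ∈ G r.1}) :
    Measurable fun r : α × Obs S => groupResidual q (G r.1) r.2 := by
  classical
  have h : Measurable fun r : α × Obs S => (r.1, r.2.1) := by fun_prop
  have e : (fun r : α × Obs S => groupResidual q (G r.1) r.2) =
      fun r => if r.2.1 ∈ G r.1 then resp r.2.2 - q r.2.1 else 0 := by
    funext r
    simp [groupResidual, Set.indicator]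
  rw [e]
  exact Measurable.ite (h hG) ((measurable_resp.comp (by fun_prop)).sub (hq.comp (by fun_prop)))
    measurable_const

theorem tendstoInftyInProb_BAG (hp : IsRegressionFunction P p)
    (D : SplitSample μ P n₁ n₂) (E : Estimator S) (G : Grouping S K n₁)
    (hconv : ConvergenceUnderAlternative P E pa parametricRate)
    (hdiff : GroupLevelDifference D G p pa)
    (hn₁ : Tendsto n₁ atTop atTop) (hn₂ : Tendsto n₂ atTop atTop) :
    TendstoInftyInProb μ (BAG D E G) := by
  obtain ⟨hpam, hpa01, hrate, hsup, c₃, h₃, hpa⟩ := hconv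
  obtain ⟨c₄, h₄, hdiff⟩ := hdiff
  intro M
  rw [ENNReal.tendsto_nhds_zero]
  intro ε hε
  have hε3 : 0 < ε / 3 := ENNReal.div_pos hε.ne' (by norm_num)
  obtain ⟨C, hC, hev⟩ := hsup.train D hn₁ hε3
  have hδ : Tendsto (fun n => C * parametricRate (n₁ n)) atTop (𝓝 0) := by
    simpa using (hrate.comp hn₁).const_mul C
  have hmeasA : ∀ n (d : Fin (n₁ n) → Obs S) k, MeasurableSet (G.group n d k) := fun n d k =>
    measurable_prodMk_left (G.measurable_group n k)
  have hgr : ∀ n k, Measurable fun r : (Fin (n₁ n) → Obs S) × Obs S =>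
      groupResidual pa (G.group n r.1 k) r.2 := fun n k =>
    measurable_groupResidual (G := fun d => G.group n d k) hpam (G.measurable_group n k)
  -- `A n`: some group mean is large; `B n k`: the `k`-th group sum is far from its mean
  set A : ℕ → Set Ω := fun n => {ω | ∃ k : Fin K,
    c₄ < |∫ z, groupResidual pa (G.group n (D.train n ω) k) z ∂P|} with hAdef
  have hAlim : Tendsto (fun n => μ (A n)ᶜ) atTop (𝓝 0) := by
    have hAm : ∀ n, MeasurableSet (A n) := by
      intro n
      have : A n = ⋃ k, {ω | c₄ < |∫ z, groupResidual pa (G.group n (D.train n ω) k) z ∂P|} := by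
        ext; simp [hAdef]
      rw [this]
      exact MeasurableSet.iUnion fun k => measurableSet_lt measurable_const
        (((hgr n k).stronglyMeasurable.integral_prod_right'.measurable).comp
          (D.measurePreserving_train n).measurable).abs
    have hA1 : Tendsto (fun n => μ (A n)) atTop (𝓝 1) := by
      refine hdiff.congr fun n => ?_
      simp only [hAdef, integral_groupResidual hp hpam hpa01 (hmeasA n _ _)]
    simp only [fun n => prob_compl_eq_one_sub (μ := μ) (hAm n)]
    simpa using ENNReal.Tendsto.sub tendsto_const_nhds hA1 (Or.inl ENNReal.one_ne_top)
  set B : ℕ → Fin K → Set Ω := fun n k => {ω | c₄ / 2 * n₂ n ≤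
    |∑ i, groupResidual pa (G.group n (D.train n ω) k) (D.test n ω i) -
      n₂ n * ∫ z, groupResidual pa (G.group n (D.train n ω) k) z ∂P|} with hBdef
  have hBbound : ∀ n k, 0 < n₂ n → μ (B n k) ≤ ENNReal.ofReal (1 / ((c₄ / 2) ^ 2 * n₂ n)) := by
    intro n k hn
    have hTT := D.measurePreserving_train_test n
    have h := measure_prod_le_abs_sum_sub_le (P := P) (m := n₂ n)
      (Measure.pi fun _ : Fin (n₁ n) => P) (hgr n k)
      (fun d z => abs_groupResidual_le hpa01 (G.group n d k) z) (half_pos h₄) hn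
    refine le_trans ?_ h
    conv_rhs => rw [← hTT.map_eq]
    exact Measure.le_map_apply hTT.measurable.aemeasurable _
  have hBlim : Tendsto (fun n => (K : ℝ≥0∞) * ENNReal.ofReal (1 / ((c₄ / 2) ^ 2 * n₂ n)))
      atTop (𝓝 0) := by
    have h1 : Tendsto (fun n => 1 / ((c₄ / 2) ^ 2 * (n₂ n : ℝ))) atTop (𝓝 0) :=
      tendsto_const_nhds.div_atTop ((tendsto_natCast_atTop_atTop.comp hn₂).const_mul_atTop
        (by positivity))
    have h2 := ENNReal.tendsto_ofReal h1
    rw [ENNReal.ofReal_zero] at h2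
    simpa using ENNReal.Tendsto.const_mul h2 (Or.inr (ENNReal.natCast_ne_top K))
  have hM : Tendsto (fun n => c₄ ^ 2 / 16 * (n₂ n : ℝ)) atTop atTop :=
    (tendsto_natCast_atTop_atTop.comp hn₂).const_mul_atTop (by positivity)
  filter_upwards [hev, hδ.eventually_le_const (half_pos h₃),
    hδ.eventually_le_const (by positivity : 0 < c₄ / 4), hn₂.eventually_gt_atTop 0,
    hM.eventually_gt_atTop M, ENNReal.tendsto_nhds_zero.1 hAlim _ hε3,
    ENNReal.tendsto_nhds_zero.1 hBlim _ hε3] with n hn hδ₃ hδ₄ hn0 hnM hnA hnB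
  have hBn : μ (⋃ k, B n k) ≤ ε / 3 := by
    refine ((measure_iUnion_fintype_le _ _).trans
      (Finset.sum_le_sum fun k _ => hBbound n k hn0)).trans ?_
    simpa using hnB
  rw [← ENNReal.add_thirds ε]
  refine le_trans (measure_mono_ae ?_) ((measure_union_le _ _).trans
    (add_le_add ((measure_union_le _ _).trans (add_le_add hn hnA)) hBn))
  filter_upwards [D.ae_forall_test hpa n] with ω hω hωM
  by_contra hnot
  have hnot' : ¬ (((ENNReal.ofReal (C * parametricRate (n₁ n)) <
      ⨆ x, ENNReal.ofReal |E.fit (n₁ n) (D.train n ω) x - pa x|) ∨ ω ∈ (A n)ᶜ) ∨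
      ω ∈ ⋃ k, B n k) := hnot
  simp only [not_or, not_lt, Set.mem_compl_iff, not_not, Set.mem_iUnion, not_exists] at hnot'
  obtain ⟨⟨hs, ⟨k, hk⟩⟩, hB⟩ := hnot'
  have hδ0 : 0 ≤ C * parametricRate (n₁ n) := by unfold parametricRate; positivity
  have hq : ∀ x, |E.fit (n₁ n) (D.train n ω) x - pa x| ≤ C * parametricRate (n₁ n) := fun x =>
    (ENNReal.ofReal_le_ofReal_iff hδ0).1 ((le_iSup (fun x =>
      ENNReal.ofReal |E.fit (n₁ n) (D.train n ω) x - pa x|) x).trans hs)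
  have hlow := le_bagStat hn0 h₃ h₄ hδ₃ hδ₄ hω hq hk (not_le.1 (hB k))
  have hωM' : bagStat (E.fit (n₁ n) (D.train n ω)) (G.group n (D.train n ω)) (D.test n ω) ≤ M :=
    hωM
  linarith

end Alternative

theorem mainTheorem3 {Ω S : Type*} [MeasurableSpace Ω] [MeasurableSpace S]
    (μ : Measure Ω) [IsProbabilityMeasure μ]
    -- the population of the pair (X, Y), and its regression function
    (P : Measure (Obs S)) [IsProbabilityMeasure P]
    (p : S → ℝ) (hp : IsRegressionFunction P p)
    -- the data with its split, the fitting procedure, and the adaptive grouping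
    (n₁ n₂ : ℕ → ℕ) (K : ℕ)
    (D : SplitSample μ P n₁ n₂) (E : Estimator S) (G : Grouping S K n₁)
    -- the model to assess; the null hypothesis is `p ∈ model`
    (model : Set (S → ℝ))
    -- the five conditions, with parametric rates
    (h1 : SufficientGroupSize D G)
    (h2 : BoundedProbability P p)
    (h3 : p ∈ model → ConvergenceUnderNull P E p parametricRate)
    (h45 : p ∉ model → ∃ pa : S → ℝ,
      ConvergenceUnderAlternative P E pa parametricRate ∧ GroupLevelDifference D G p pa)
    -- the splitting ratio
    (hn₁ : ∀ᶠ n in atTop, 0 < n₁ n)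
    (hn₂ : Tendsto n₂ atTop atTop)
    (hratio : Tendsto (fun n => (n₂ n : ℝ) / n₁ n) atTop (𝓝 0)) :
    (p ∈ model →
      TendstoInDistribution (BAG D E G) atTop id (fun _ => μ) (chiSquared K)) ∧
    (p ∉ model → TendstoInftyInProb μ (BAG D E G)) := by
  have hn₁' := tendsto_atTop_of_ratio_tendsto_zero hn₁ hn₂ hratio
  refine ⟨fun hmem => ?_, fun hmem => ?_⟩
  · exact tendstoInDistribution_BAG hp D E G h1 h2 (h3 hmem).2 hn₁' hn₂ hratio
  · obtain ⟨pa, hconv, hdiff⟩ := h45 hmem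
    exact tendstoInftyInProb_BAG hp D E G hconv hdiff hn₁' hn₂
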